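/- Let $\Bbbk$ be a field and let $\mathcal{P} = \mathcal{T}_1 \times \cdots \times \mathcal{T}_n$ be a grid poset, that is, a finite Cartesian product of (possibly infinite) totally ordered sets with the product order; for instance $\mathcal{P} = \mathbb{R}^n$. A representation of $\mathcal{P}$ is a functor from $\mathcal{P}$ to the category of $\Bbbk$-vector spaces. For a convex subset $S \subseteq \mathcal{P}$ (if $a \le p \le b$ and $a, b \in S$ then $p \in S$), let $\Bbbk_S$ be the representation that takes the value $\Bbbk$ on $S$ and $0$ elsewhere, with structure morphism $p \le q$ equal to the identity of $\Bbbk$ if $p, q \in S$ and to $0$ otherwise. Let $\operatorname{rep}\mathcal{P}$ be the full subcategory of finitely presented representations, i.e. cokernels of morphisms between finite direct sums of representations $\Bbbk_{\{q \,:\, q \ge p\}}$ with $p \in \mathcal{P}$. A spread is a convex subset $S \subseteq \mathcal{P}$ that is non-empty and in which any two elements are joined by a finite zigzag of comparable elements of $S$; then $\Bbbk_S$ is called a spread representation. An object of $\operatorname{rep}\mathcal{P}$ is spread-decomposable if it is isomorphic to a direct summand of a finite (possibly empty) direct sum of finitely presented spread representations. The spread exact structure on $\operatorname{rep}\mathcal{P}$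 consists of the short exact sequences of $\operatorname{rep}\mathcal{P}$ that remain short exact after applying $\operatorname{Hom}(X, -)$ for every finitely presented spread representation $X$; an object $M$ is projective for it if $\operatorname{Hom}(M, -)$ sends all of these sequences to short exact sequences. A spread-approximation of $M \in \operatorname{rep}\mathcal{P}$ is a morphism $C \to M$ with $C$ spread-decomposable such that every morphism $Z \to M$ with $Z$ spread-decomposable factors through it. A spread-resolution of $M$ is a sequence $\cdots \to C_2 \xrightarrow{f_2} C_1 \xrightarrow{f_1} C_0 \xrightarrow{f_0} M$ in $\operatorname{rep}\mathcal{P}$ in which $f_0$ is a spread-approximation of $M$ and, for each $i \ge 1$, $f_i$ is the composite of a spread-approximation $C_i \to \ker f_{i-1}$ with the inclusion $\ker f_{i-1} \to C_{i-1}$; it is finite if $C_i = 0$ for all sufficiently large $i$. Then: 1. an object of $\operatorname{rep}\mathcal{P}$ is projective for the spread exact structure if and only if it is spread-decomposable; 2. every object of $\operatorname{rep}\mathcal{P}$ admits a finite spread-resolution. -/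

import Mathlib

open CategoryTheory CategoryTheory.Limits

universe u v w w'

noncomputable section

/-! ### Relative homological algebra -/

section Relative

variable {A : Type w} [Category.{w'} A] [Preadditive A]

/-- The class `F_𝒳`: short exact sequences `0 ⟶ S₁ ⟶ S₂ ⟶ S₃ ⟶ 0` of `A` such that
`0 ⟶ Hom(X, S₁) ⟶ Hom(X, S₂) ⟶ Hom(X, S₃) ⟶ 0` is a short exact sequence of abelian groups
for every `X` in `𝒳`. -/
def RelativeShortExact (𝒳 : ObjectProperty A) (S : ShortComplex A) : Prop :=
  S.ShortExact ∧
    ∀ X : A, 𝒳 X → (S.map (preadditiveCoyoneda.obj (Opposite.op X))).ShortExact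

/-- The projective objects of the exact structure `F_𝒳`: the functor `Hom(M, -)` sends the
sequences in `F_𝒳` to short exact sequences of abelian groups. -/
def RelativeProjective (𝒳 : ObjectProperty A) (M : A) : Prop :=
  ∀ S : ShortComplex A, RelativeShortExact 𝒳 S →
    (S.map (preadditiveCoyoneda.obj (Opposite.op M))).ShortExact

/-- The additive closure of `𝒳`: the objects `M` that are direct summands of finite direct sums
of objects of `𝒳`, that is, `M ⊕ N ≅ X₁ ⊕ ⋯ ⊕ Xₘ` for some object `N` and some `Xᵢ` in `𝒳`
(where `m = 0` is allowed). -/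
def addClosure (𝒳 : ObjectProperty A) : ObjectProperty A := fun M =>
  ∃ (m : ℕ) (X : Fin m → A) (N : A) (s : BinaryBicone M N) (b : Bicone X),
    (∀ i, 𝒳 (X i)) ∧ Nonempty s.IsBilimit ∧ Nonempty b.IsBilimit ∧ Nonempty (s.pt ≅ b.pt)

/-- A morphism `f : C ⟶ M` is a `𝒞`-approximation if `C` is in `𝒞` and every morphism to `M`
from an object of `𝒞` factors through `f`. -/
def IsApproximation (𝒞 : ObjectProperty A) {C M : A} (f : C ⟶ M) : Prop :=
  𝒞 C ∧ ∀ Z : A, 𝒞 Z → Function.Surjective (fun h : Z ⟶ C => h ≫ f)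

/-- The morphism `f` has a kernel in `A`, and `g` is the composite of a `𝒞`-approximation
`C ⟶ ker f` with the inclusion `ker f ⟶ C'`. -/
def IsKernelApproximation (𝒞 : ObjectProperty A) {C C' C'' : A} (g : C ⟶ C') (f : C' ⟶ C'') :
    Prop :=
  ∃ (κ : KernelFork f) (a : C ⟶ κ.pt),
    Nonempty (IsLimit κ) ∧ IsApproximation 𝒞 a ∧ a ≫ κ.ι = g

/-- A `𝒞`-resolution `⋯ ⟶ C 2 ⟶ C 1 ⟶ C 0 ⟶ M ⟶ 0`. -/
structure RelativeResolution (𝒞 : ObjectProperty A) (M : A) where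
  C : ℕ → A
  ε : C 0 ⟶ M
  d : ∀ i, C (i + 1) ⟶ C i
  approx_ε : IsApproximation 𝒞 ε
  approx_d_zero : IsKernelApproximation 𝒞 (d 0) ε
  approx_d_succ : ∀ i, IsKernelApproximation 𝒞 (d (i + 1)) (d i)

/-- A resolution is finite if `C i = 0` for all large `i`. -/
def RelativeResolution.IsFinite {𝒞 : ObjectProperty A} {M : A} (R : RelativeResolution 𝒞 M) :
    Prop :=
  ∃ n : ℕ, ∀ i, n < i → IsZero (R.C i)

end Relative

/-! ### Representations of posets -/

/-- Representations of the poset `P` over the field `k`: functors from `P` to vector spaces. -/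
abbrev PosetRep (k : Type v) [Field k] (P : Type u) [PartialOrder P] := P ⥤ ModuleCat.{v} k

section Poset

variable (k : Type v) [Field k] {P : Type u} [PartialOrder P]

/-- The value at `p` of the indicator representation of `S`, as a subspace of `k`:
it is `k` if `p ∈ S`, and it is `0` otherwise. -/
def indicatorValue (S : Set P) (p : P) : Submodule k k where
  carrier := {x | p ∉ S → x = 0}
  add_mem' := fun ha hb hp => by rw [ha hp, hb hp, add_zero]
  zero_mem' := fun _ => rfl
  smul_mem' := fun c x hx hp => by rw [hx hp, smul_zero]

open Classical in
/-- The structure morphism `p ≤ q` of the indicator representation of `S`: it is the identity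
of `k` if `p, q ∈ S`, and it is `0` otherwise. -/
def indicatorMap (S : Set P) (p q : P) : indicatorValue k S p →ₗ[k] indicatorValue k S q where
  toFun x := ⟨if p ∈ S ∧ q ∈ S then (x : k) else 0, fun hq => by simp [hq]⟩
  map_add' x y := by ext; by_cases h : p ∈ S ∧ q ∈ S <;> simp [h]
  map_smul' c x := by ext; by_cases h : p ∈ S ∧ q ∈ S <;> simp [h]

theorem indicatorMap_self {P : Type u} (S : Set P) (p : P) : indicatorMap k S p p = LinearMap.id := by
  ext x
  by_cases hp : p ∈ S
  · simp [indicatorMap, hp]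
  · simp [indicatorMap, hp, x.2 hp]

theorem indicatorMap_comp {S : Set P} (hS : S.OrdConnected) {p q r : P} (hpq : p ≤ q)
    (hqr : q ≤ r) : (indicatorMap k S q r).comp (indicatorMap k S p q) = indicatorMap k S p r := by
  ext x
  by_cases hp : p ∈ S <;> by_cases hr : r ∈ S
  · have hq : q ∈ S := hS.out hp hr ⟨hpq, hqr⟩
    simp [indicatorMap, hp, hq, hr]
  all_goals simp [indicatorMap, hp, hr]

/-- The indicator representation of a convex subset `S` of `P`; convexity is `Set.OrdConnected`:
`a ≤ p ≤ b` with `a, b ∈ S` implies `p ∈ S`. -/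
def indicatorRep (S : Set P) (hS : S.OrdConnected) : PosetRep k P where
  obj p := ModuleCat.of k (indicatorValue k S p)
  map {p q} _ := ModuleCat.ofHom (indicatorMap k S p q)
  map_id p := by
    rw [indicatorMap_self]
    rfl
  map_comp {p q r} f g := by
    rw [← ModuleCat.ofHom_comp, indicatorMap_comp k hS (leOfHom f) (leOfHom g)]

/-- A spread: a convex subset that is non-empty and in which any two elements are connected by a
zigzag of comparable elements. -/
structure IsSpread (S : Set P) : Prop where
  ordConnected : S.OrdConnected
  nonempty : S.Nonempty
  zigzag : ∀ s ∈ S, ∀ t ∈ S,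
    Relation.ReflTransGen (fun a b : P => a ∈ S ∧ b ∈ S ∧ (a ≤ b ∨ b ≤ a)) s t

/-- The representation of the principal upset of `p`. -/
def upsetRep (p : P) : PosetRep k P := indicatorRep k (Set.Ici p) Set.ordConnected_Ici

variable (P)

/-- A representation is finitely presented if it is the cokernel of a morphism between finite
direct sums (coproducts) of representations of principal upsets. -/
def isFinitelyPresentedRep : ObjectProperty (PosetRep k P) := fun M =>
  ∃ (m n : ℕ) (a : Fin m → P) (b : Fin n → P)
    (f : (∐ fun i => upsetRep k (a i)) ⟶ (∐ fun j => upsetRep k (b j))),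
    Nonempty (M ≅ cokernel f)

/-- The category of finitely presented representations, a full subcategory of the category of
representations. -/
abbrev FPRep := (isFinitelyPresentedRep k P).FullSubcategory

/-- The finitely presented representations that are (isomorphic to) spread representations. -/
def isSpreadRep : ObjectProperty (FPRep k P) := fun M =>
  ∃ (S : Set P) (hS : IsSpread S), Nonempty (M.obj ≅ indicatorRep k S hS.ordConnected)

/-- The spread-decomposable representations: the additive closure of the finitely presented
spread representations. -/
def isSpreadDecomposable : ObjectProperty (FPRep k P) := addClosure (isSpreadRep k P)

end Poset

end

/-! The coordinates of the generators and relations of a finitely presented `M` span a finite grid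
`G`. Call two points equivalent if they lie above the same elements of `G`; the classes are the
cells. Then `M` is tame (`IsTame`): its structure maps inside a cell are isomorphisms, it vanishes
at points above no element of `G`, and it is pointwise finite-dimensional. Kernels of maps between
tame representations are tame for the same `G`. Two facts about tame representations carry the
proof.

Finiteness. Only finitely many spreads are unions of cells of points above `G`. They join the
approximating class one at a time, in an order for which every map from an older spread to the new
one `T` factors through a subobject of `T` that is a sum of older ones; since `T` has only scalar
endomorphisms, each step preserves finite relative dimension (`HasFiniteApproxDim.insert`). The
order: enlarge the allowed support in `G` by a minimal point `p` at a time, and among the spreads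
then allowed put `T` before those that map to it nontrivially at `p`. Older spreads then map to `T`
with value zero at `p`, hence into `T` with the cell of `p` removed, whose components avoid `p`.

Reduction to tame spreads. A map from any convex indicator representation to a tame `M` factors
through that of a tame convex set (`exists_factorization_bounded`,
`exists_factorization_of_bounded`), which is a finite sum of tame spread representations
(`IsTameSet.finiteSum`). Thus approximations by tame spreads are approximations by all spreads. This
uses that cells above `G` are closed under joins, a property of products of chains
(`floorLESup_piFinset`).

Iterating approximations gives the finite resolutions. An approximation is also an epimorphism,
because principal upsets are convex, so its kernel sequence is spread exact and splits when `M` is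
relatively projective. The converse is formal. -/

noncomputable section

/-! ### Elementwise calculus for representations and indicator representations. -/

section Representation

variable {k : Type v} [Field k] {P : Type u} [PartialOrder P]

theorem PosetRep.naturality {M N : PosetRep k P} (f : M ⟶ N) {p q : P} (h : p ⟶ q) (x : M.obj p) :
    (f.app q).hom ((M.map h).hom x) = (N.map h).hom ((f.app p).hom x) := by
  have := f.naturality h
  exact congrArg (fun g => g.hom x) this

theorem PosetRep.map_map (M : PosetRep k P) {p q r : P} (h : p ⟶ q) (h' : q ⟶ r) (x : M.obj p) :
    (M.map h').hom ((M.map h).hom x) = (M.map (h ≫ h')).hom x := by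
  rw [M.map_comp]
  rfl

theorem PosetRep.map_self (M : PosetRep k P) {p : P} (h : p ⟶ p) (x : M.obj p) :
    (M.map h).hom x = x := by
  obtain rfl : h = 𝟙 p := Subsingleton.elim _ _
  rw [M.map_id]
  rfl

theorem PosetRep.hom_ext {M N : PosetRep k P} {f g : M ⟶ N}
    (h : ∀ p (x : M.obj p), (f.app p).hom x = (g.app p).hom x) : f = g := by
  ext p x
  exact h p x

end Representation

section Indicator

variable {k : Type v} [Field k] {P : Type u} [PartialOrder P] {S T : Set P}
  {hS : S.OrdConnected} {hT : T.OrdConnected}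

/-- The inclusion of the value of an indicator representation into `k`. -/
def indicatorCoeff (hS : S.OrdConnected) (p : P) : (indicatorRep k S hS).obj p →ₗ[k] k :=
  (indicatorValue k S p).subtype

/-- The generator `1` of the value of the indicator representation of `S` at `p ∈ S`. -/
def indicatorGen (k : Type v) [Field k] (hS : S.OrdConnected) {p : P} (hp : p ∈ S) :
    (indicatorRep k S hS).obj p :=
  (⟨1, fun h => absurd hp h⟩ : indicatorValue k S p)

theorem indicatorCoeff_injective (p : P) :
    Function.Injective (indicatorCoeff (k := k) hS p) :=
  Subtype.val_injective

theorem indicatorCoeff_gen {p : P} (hp : p ∈ S) : indicatorCoeff hS p (indicatorGen k hS hp) = 1 :=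
  rfl

theorem indicatorCoeff_eq_zero {p : P} (hp : p ∉ S) (x : (indicatorRep k S hS).obj p) :
    indicatorCoeff hS p x = 0 :=
  Subtype.prop (p := (· ∈ indicatorValue k S p)) x hp

theorem indicator_eq_zero {p : P} (hp : p ∉ S) (x : (indicatorRep k S hS).obj p) : x = 0 :=
  indicatorCoeff_injective p (by rw [indicatorCoeff_eq_zero hp, map_zero])

theorem indicatorCoeff_smul_gen {p : P} (hp : p ∈ S) (x : (indicatorRep k S hS).obj p) :
    indicatorCoeff hS p x • indicatorGen k hS hp = x :=
  indicatorCoeff_injective p (by rw [map_smul, indicatorCoeff_gen, smul_eq_mul, mul_one])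

theorem indicatorGen_ne_zero {p : P} (hp : p ∈ S) : indicatorGen k hS hp ≠ 0 := fun h => by
  have := indicatorCoeff_gen (k := k) (hS := hS) hp
  rw [h, map_zero] at this
  exact zero_ne_one this

theorem indicatorCoeff_map {p q : P} (h : p ⟶ q) (hq : q ∈ S)
    (x : (indicatorRep k S hS).obj p) :
    indicatorCoeff hS q (((indicatorRep k S hS).map h).hom x) = indicatorCoeff hS p x := by
  by_cases hp : p ∈ S
  · exact if_pos ⟨hp, hq⟩
  · rw [indicator_eq_zero hp x, map_zero, map_zero, map_zero]

theorem indicator_map_gen {p q : P} (h : p ⟶ q) (hp : p ∈ S) (hq : q ∈ S) :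
    ((indicatorRep k S hS).map h).hom (indicatorGen k hS hp) = indicatorGen k hS hq :=
  indicatorCoeff_injective q (by rw [indicatorCoeff_map h hq]; rfl)

/-- The image of the generator at `p`. -/
def indicatorImage {M : PosetRep k P} (f : indicatorRep k S hS ⟶ M)
    {p : P} (hp : p ∈ S) : M.obj p :=
  (f.app p).hom (indicatorGen k hS hp)

theorem app_eq_smul_indicatorImage {M : PosetRep k P}
    (f : indicatorRep k S hS ⟶ M) {p : P} (hp : p ∈ S) (x : (indicatorRep k S hS).obj p) :
    (f.app p).hom x = indicatorCoeff hS p x • indicatorImage f hp := by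
  rw [indicatorImage, ← map_smul, indicatorCoeff_smul_gen]

theorem app_eq_zero_of_notMem {M : PosetRep k P}
    (f : indicatorRep k S hS ⟶ M) {p : P} (hp : p ∉ S) (x : (indicatorRep k S hS).obj p) :
    (f.app p).hom x = 0 := by
  rw [indicator_eq_zero hp x, map_zero]

theorem map_indicatorImage {M : PosetRep k P}
    (f : indicatorRep k S hS ⟶ M) {p q : P} (h : p ⟶ q) (hp : p ∈ S) (hq : q ∈ S) :
    (M.map h).hom (indicatorImage f hp) = indicatorImage f hq := by
  rw [indicatorImage, ← PosetRep.naturality, indicator_map_gen h hp hq]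
  rfl

theorem map_indicatorImage_of_notMem {M : PosetRep k P}
    (f : indicatorRep k S hS ⟶ M) {p q : P} (h : p ⟶ q) (hp : p ∈ S) (hq : q ∉ S) :
    (M.map h).hom (indicatorImage f hp) = 0 := by
  rw [indicatorImage, ← PosetRep.naturality, app_eq_zero_of_notMem f hq]

theorem indicatorRep_hom_ext {M : PosetRep k P} {f g : indicatorRep k S hS ⟶ M}
    (h : ∀ p (hp : p ∈ S), indicatorImage f hp = indicatorImage g hp) : f = g := by
  refine PosetRep.hom_ext fun p x => ?_
  by_cases hp : p ∈ S
  · rw [app_eq_smul_indicatorImage f hp x, app_eq_smul_indicatorImage g hp x, h p hp]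
  · rw [app_eq_zero_of_notMem f hp, app_eq_zero_of_notMem g hp]

theorem indicatorImage_comp {M N : PosetRep k P}
    (f : indicatorRep k S hS ⟶ M) (g : M ⟶ N) {p : P} (hp : p ∈ S) :
    indicatorImage (f ≫ g) hp = (g.app p).hom (indicatorImage f hp) := rfl

theorem indicatorImage_add {M : PosetRep k P} (f g : indicatorRep k S hS ⟶ M) {p : P}
    (hp : p ∈ S) : indicatorImage (f + g) hp = indicatorImage f hp + indicatorImage g hp := rfl

theorem indicatorImage_smul {M : PosetRep k P} (c : k) (f : indicatorRep k S hS ⟶ M) {p : P}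
    (hp : p ∈ S) : indicatorImage (c • f) hp = c • indicatorImage f hp := rfl

theorem indicatorImage_id {p : P} (hp : p ∈ S) :
    indicatorImage (𝟙 (indicatorRep k S hS)) hp = indicatorGen k hS hp := rfl

/-- The morphism out of an indicator representation given by the images `y p` of the
generators. -/
def indicatorDesc (hS : S.OrdConnected) (M : PosetRep k P) (y : ∀ p, M.obj p)
    (h₁ : ∀ (p q : P) (h : p ⟶ q), p ∈ S → q ∈ S → (M.map h).hom (y p) = y q)
    (h₀ : ∀ (p q : P) (h : p ⟶ q), p ∈ S → q ∉ S → (M.map h).hom (y p) = 0) :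
    indicatorRep k S hS ⟶ M where
  app p := ModuleCat.ofHom ((LinearMap.toSpanSingleton k _ (y p)).comp (indicatorCoeff hS p))
  naturality p q h := by
    ext x
    change indicatorCoeff hS q (((indicatorRep k S hS).map h).hom x) • y q =
      (M.map h).hom (indicatorCoeff hS p x • y p)
    rw [map_smul]
    by_cases hp : p ∈ S
    · by_cases hq : q ∈ S
      · rw [indicatorCoeff_map h hq, h₁ p q h hp hq]
      · rw [indicatorCoeff_eq_zero hq, h₀ p q h hp hq, zero_smul, smul_zero]
    · rw [indicator_eq_zero hp x, map_zero, map_zero, map_zero, zero_smul, zero_smul]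

theorem indicatorImage_indicatorDesc (M : PosetRep k P) (y : ∀ p, M.obj p)
    (h₁ : ∀ (p q : P) (h : p ⟶ q), p ∈ S → q ∈ S → (M.map h).hom (y p) = y q)
    (h₀ : ∀ (p q : P) (h : p ⟶ q), p ∈ S → q ∉ S → (M.map h).hom (y p) = 0)
    {p : P} (hp : p ∈ S) : indicatorImage (indicatorDesc hS M y h₁ h₀) hp = y p := by
  change indicatorCoeff hS p (indicatorGen k hS hp) • y p = y p
  rw [indicatorCoeff_gen, one_smul]

open Classical in
/-- The morphism out of an indicator representation given by the images `y p hp` of the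
generators. -/
theorem exists_indicatorDesc (hS : S.OrdConnected) (M : PosetRep k P) (y : ∀ p, p ∈ S → M.obj p)
    (h₁ : ∀ (p q : P) (h : p ⟶ q) (hp : p ∈ S) (hq : q ∈ S), (M.map h).hom (y p hp) = y q hq)
    (h₀ : ∀ (p q : P) (h : p ⟶ q) (hp : p ∈ S), q ∉ S → (M.map h).hom (y p hp) = 0) :
    ∃ f : indicatorRep k S hS ⟶ M, ∀ p (hp : p ∈ S), indicatorImage f hp = y p hp := by
  refine ⟨indicatorDesc hS M (fun p => if hp : p ∈ S then y p hp else 0) ?_ ?_, ?_⟩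
  · intro p q h hp hq
    rw [dif_pos hp, dif_pos hq, h₁]
  · intro p q h hp hq
    rw [dif_pos hp, h₀ _ _ h hp hq]
  · intro p hp
    rw [indicatorImage_indicatorDesc, dif_pos hp]

open Classical in
/-- The morphism of indicator representations which is the identity of `k` on `S ∩ T`. -/
theorem exists_indicatorHom (k : Type v) [Field k] (hS : S.OrdConnected) (hT : T.OrdConnected)
    (h : ∀ p q, p ≤ q → p ∈ S → q ∈ T → (q ∈ S ↔ p ∈ T)) :
    ∃ f : indicatorRep k S hS ⟶ indicatorRep k T hT,
      ∀ p (_ : p ∈ S) (hp : p ∈ T) , indicatorImage f ‹p ∈ S› = indicatorGen k hT hp := by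
  obtain ⟨f, hf⟩ := exists_indicatorDesc hS (indicatorRep k T hT)
    (fun p _ => if hp : p ∈ T then indicatorGen k hT hp else 0)
    (by
      intro p q f hp hq
      by_cases hqT : q ∈ T
      · have hpT : p ∈ T := (h p q (leOfHom f) hp hqT).1 hq
        rw [dif_pos hpT, dif_pos hqT, indicator_map_gen]
      · exact (indicator_eq_zero hqT _).trans (indicator_eq_zero hqT _).symm)
    (by
      intro p q f hp hq
      by_cases hqT : q ∈ T
      · have hpT : p ∉ T := fun hpT => hq ((h p q (leOfHom f) hp hqT).2 hpT)
        rw [dif_neg hpT, map_zero]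
      · exact indicator_eq_zero hqT _)
  refine ⟨f, fun p hp hpT => ?_⟩
  rw [hf, dif_pos hpT]

/-- The endomorphisms of an indicator representation of a spread are scalars. -/
theorem exists_eq_smul_id (hS : IsSpread S)
    (f : indicatorRep k S hS.ordConnected ⟶ indicatorRep k S hS.ordConnected) :
    ∃ c : k, f = c • 𝟙 _ := by
  obtain ⟨s, hs⟩ := hS.nonempty
  have key : ∀ a b : P, (a ∈ S ∧ b ∈ S ∧ (a ≤ b ∨ b ≤ a)) → ∀ (ha : a ∈ S) (hb : b ∈ S),
      indicatorCoeff _ a (indicatorImage f ha) = indicatorCoeff _ b (indicatorImage f hb) := by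
    have aux : ∀ a b : P, a ≤ b → ∀ (ha : a ∈ S) (hb : b ∈ S),
        indicatorCoeff _ a (indicatorImage f ha) = indicatorCoeff _ b (indicatorImage f hb) := by
      intro a b hab ha hb
      rw [← map_indicatorImage f (homOfLE hab) ha hb, indicatorCoeff_map _ hb]
    rintro a b ⟨-, -, h | h⟩ ha hb
    · exact aux a b h ha hb
    · exact (aux b a h hb ha).symm
  -- The coefficient of `f` is constant along comparabilities, hence along zigzags, so on all of
  -- `S`.
  have main : ∀ t (ht : t ∈ S),
      indicatorCoeff _ s (indicatorImage f hs) = indicatorCoeff _ t (indicatorImage f ht) := by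
    intro t ht
    have := hS.zigzag s hs t ht
    induction this with
    | refl => rfl
    | tail _ h ih => exact (ih h.1).trans (key _ _ h _ _)
  refine ⟨indicatorCoeff _ s (indicatorImage f hs), indicatorRep_hom_ext fun p hp => ?_⟩
  refine indicatorCoeff_injective p ?_
  rw [main p hp, indicatorImage_smul, indicatorImage_id, map_smul, indicatorCoeff_gen,
    smul_eq_mul, mul_one]

/-- A subrepresentation given by a subset closed upwards, as a monomorphism. -/
theorem exists_mono_indicatorRep (k : Type v) [Field k] (hS : S.OrdConnected)
    (hT : T.OrdConnected) (hST : S ⊆ T) (h : ∀ p q, p ≤ q → p ∈ S → q ∈ T → q ∈ S) :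
    ∃ i : indicatorRep k S hS ⟶ indicatorRep k T hT, Mono i ∧
      ∀ (M : PosetRep k P) (f : M ⟶ indicatorRep k T hT),
        (∀ p, p ∉ S → ∀ x, (f.app p).hom x = 0) → ∃ g : M ⟶ indicatorRep k S hS, g ≫ i = f := by
  obtain ⟨i, hi⟩ := exists_indicatorHom k hS hT
    (fun p q hpq hp hq => ⟨fun _ => hST hp, fun _ => h p q hpq hp hq⟩)
  have hcoeff : ∀ p (x : (indicatorRep k S hS).obj p),
      indicatorCoeff hT p ((i.app p).hom x) = indicatorCoeff hS p x := by
    intro p x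
    by_cases hp : p ∈ S
    · rw [app_eq_smul_indicatorImage i hp, hi p hp (hST hp), map_smul, indicatorCoeff_gen,
        smul_eq_mul, mul_one]
    · rw [indicator_eq_zero hp x, map_zero, map_zero, map_zero]
  have hinj : ∀ p, Function.Injective (i.app p).hom := fun p x y hxy =>
    indicatorCoeff_injective p (by rw [← hcoeff, ← hcoeff, hxy])
  refine ⟨i, ?_, fun M f hf => ?_⟩
  · rw [NatTrans.mono_iff_mono_app]
    intro p
    rw [ModuleCat.mono_iff_injective]
    exact hinj p
  · have hmem : ∀ p x, (f.app p).hom x ∈ LinearMap.range (i.app p).hom := by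
      intro p x
      by_cases hp : p ∈ S
      · refine ⟨indicatorCoeff hT p ((f.app p).hom x) • indicatorGen k hS hp, ?_⟩
        refine indicatorCoeff_injective p ?_
        rw [hcoeff, map_smul, indicatorCoeff_gen, smul_eq_mul, mul_one]
      · rw [hf p hp]
        exact Submodule.zero_mem _
    have hsp : ∀ p x, (i.app p).hom ((LinearEquiv.ofInjective _ (hinj p)).symm
        ⟨(f.app p).hom x, hmem p x⟩) = (f.app p).hom x := by
      intro p x
      exact congrArg Subtype.val ((LinearEquiv.ofInjective _ (hinj p)).apply_symm_apply
        ⟨(f.app p).hom x, hmem p x⟩)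
    refine ⟨{ app p := ModuleCat.ofHom ((LinearEquiv.ofInjective _ (hinj p)).symm.toLinearMap.comp
                ((f.app p).hom.codRestrict _ (hmem p)))
              naturality p q a := ?_ }, ?_⟩
    · ext x
      refine hinj q ?_
      refine (hsp q _).trans ?_
      refine Eq.trans ?_ (PosetRep.naturality i a _).symm
      exact (PosetRep.naturality f a x).trans
        (congrArg (((indicatorRep k T hT).map a).hom) (hsp p x).symm)
    · exact PosetRep.hom_ext fun p x => hsp p x

end Indicator

/-! ### Finite relative dimension and enlargement of the approximating class. -/

section FiniteSums

variable {A : Type w} [Category.{w'} A] [Abelian A]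

attribute [local instance] Abelian.hasFiniteBiproducts

/-- The finite direct sums of objects of `𝒴`. -/
def FiniteSum (𝒴 : ObjectProperty A) : ObjectProperty A := fun M =>
  ∃ (J : Type) (_ : Fintype J) (X : J → A), (∀ j, 𝒴 (X j)) ∧ Nonempty (M ≅ ⨁ X)

variable {𝒴 𝒴' : ObjectProperty A}

theorem FiniteSum.mono (h : ∀ Y, 𝒴 Y → 𝒴' Y) {M : A} (hM : FiniteSum 𝒴 M) : FiniteSum 𝒴' M := by
  obtain ⟨J, _, X, hX, e⟩ := hM
  exact ⟨J, inferInstance, X, fun j => h _ (hX j), e⟩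

theorem FiniteSum.of_iso {M N : A} (e : M ≅ N) (hM : FiniteSum 𝒴 M) : FiniteSum 𝒴 N := by
  obtain ⟨J, _, X, hX, ⟨e'⟩⟩ := hM
  exact ⟨J, inferInstance, X, hX, ⟨e.symm ≪≫ e'⟩⟩

theorem FiniteSum.of_isZero {M : A} (hM : IsZero M) : FiniteSum 𝒴 M := by
  refine ⟨PEmpty, inferInstance, PEmpty.elim, fun j => PEmpty.elim j, ⟨hM.iso ?_⟩⟩
  rw [IsZero.iff_id_eq_zero]
  exact biproduct.hom_ext _ _ fun j => PEmpty.elim j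

theorem FiniteSum.of_mem {M : A} (hM : 𝒴 M) : FiniteSum 𝒴 M :=
  ⟨PUnit, inferInstance, fun _ => M, fun _ => hM, 
    ⟨(biproductUniqueIso fun _ : PUnit => M).symm⟩⟩

theorem FiniteSum.biproduct {J : Type} [Fintype J] {X : J → A} (h : ∀ j, FiniteSum 𝒴 (X j)) :
    FiniteSum 𝒴 (⨁ X) := by
  choose K _ Y hY e using h
  refine ⟨Σ j, K j, inferInstance, fun p => Y p.1 p.2, fun p => hY _ _, ⟨?_⟩⟩
  exact Limits.biproduct.mapIso (fun j => (e j).some) ≪≫ biproductBiproductIso _ _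

theorem FiniteSum.biprod {M N : A} (hM : FiniteSum 𝒴 M) (hN : FiniteSum 𝒴 N) :
    FiniteSum 𝒴 (M ⊞ N) := by
  have : FiniteSum 𝒴 (⨁ pairFunction M N) :=
    FiniteSum.biproduct (by rintro (_ | _); exacts [hM, hN])
  exact this.of_iso (biprod.uniqueUpToIso M N
    
    ((Bicone.toBinaryBiconeIsBilimit _).symm (biproduct.isBilimit (pairFunction M N))))

theorem FiniteSum.exists_lift {Z C M : A} (f : C ⟶ M) (hZ : FiniteSum 𝒴 Z)
    (h : ∀ Y, 𝒴 Y → ∀ g : Y ⟶ M, ∃ l, l ≫ f = g) (g : Z ⟶ M) : ∃ l, l ≫ f = g := by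
  obtain ⟨J, _, X, hX, ⟨e⟩⟩ := hZ
  choose l hl using fun j => h (X j) (hX j) (biproduct.ι X j ≫ e.inv ≫ g)
  refine ⟨e.hom ≫ biproduct.desc l, ?_⟩
  rw [Category.assoc, ← Iso.eq_inv_comp]
  refine biproduct.hom_ext' _ _ fun j => ?_
  rw [biproduct.ι_desc_assoc, hl]

/-- The objects with a finite resolution by finite direct sums of objects of `𝒴`, which is exact
after applying `Hom(Y, -)` for every `Y` in `𝒴`. -/
inductive HasFiniteApproxDim (𝒴 : ObjectProperty A) : A → Prop
  | zero (M : A) : IsZero M → HasFiniteApproxDim 𝒴 M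
  | step {K C M : A} (i : K ⟶ C) (f : C ⟶ M) (w : i ≫ f = 0) :
      Nonempty (IsLimit (KernelFork.ofι i w)) → FiniteSum 𝒴 C →
      (∀ Y, 𝒴 Y → ∀ g : Y ⟶ M, ∃ h, h ≫ f = g) →
      HasFiniteApproxDim 𝒴 K → HasFiniteApproxDim 𝒴 M

theorem HasFiniteApproxDim.step_kernel {C M : A} (f : C ⟶ M) (hC : FiniteSum 𝒴 C)
    (hf : ∀ Y, 𝒴 Y → ∀ g : Y ⟶ M, ∃ h, h ≫ f = g) (h : HasFiniteApproxDim 𝒴 (kernel f)) :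
    HasFiniteApproxDim 𝒴 M :=
  .step (kernel.ι f) f (kernel.condition f) ⟨kernelIsKernel f⟩ hC hf h

/-- Objects of `𝒴` cannot distinguish `L` from `K`: composing the first approximation of `L` with
`j` leaves its kernel unchanged and still catches all maps to `K`. -/
theorem HasFiniteApproxDim.of_mono {L K : A} (j : L ⟶ K) [Mono j]
    (hj : ∀ Y, 𝒴 Y → ∀ g : Y ⟶ K, ∃ h, h ≫ j = g) (hL : HasFiniteApproxDim 𝒴 L) :
    HasFiniteApproxDim 𝒴 K := by
  cases hL with
  | zero _ h =>
    exact .step_kernel j (.of_isZero h) hj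
      (.zero _ (IsZero.of_iso (isZero_zero _) (kernel.ofMono j)))
  | step i f w hk hC hf hK =>
    refine .step i (f ≫ j) (by rw [reassoc_of% w, zero_comp])
      ⟨isKernelCompMono hk.some j rfl⟩ hC (fun Y hY g => ?_) hK
    obtain ⟨h, rfl⟩ := hj Y hY g
    obtain ⟨h', rfl⟩ := hf Y hY h
    exact ⟨h', (Category.assoc _ _ _).symm⟩

theorem HasFiniteApproxDim.biprod {K N : A} (hK : HasFiniteApproxDim 𝒴 K) (hN : FiniteSum 𝒴 N) :
    HasFiniteApproxDim 𝒴 (K ⊞ N) := by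
  cases hK with
  | zero _ h =>
    refine .step_kernel (biprod.inr : N ⟶ K ⊞ N) hN (fun Y hY g => ⟨g ≫ biprod.snd, ?_⟩)
      (.zero _ (IsZero.of_iso (isZero_zero _) (kernel.ofMono _)))
    ext
    · exact h.eq_of_tgt _ _
    · simp
  | step i f w hk hC hf hK =>
    refine .step (i ≫ biprod.inl) (biprod.map f (𝟙 N))
      (by simp [reassoc_of% w]) ⟨?_⟩ (hC.biprod hN)
      (fun Y hY g => ?_) hK
    · refine KernelFork.IsLimit.ofι _ _
        (fun g hg => hk.some.lift (KernelFork.ofι (g ≫ biprod.fst) ?_)) ?_ ?_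
      · have := congrArg (· ≫ biprod.fst) hg
        simpa using this
      · intro W g hg
        have h1 : hk.some.lift (KernelFork.ofι (g ≫ biprod.fst) (by
          have := congrArg (· ≫ biprod.fst) hg
          simpa using this)) ≫ i = g ≫ biprod.fst := Fork.IsLimit.lift_ι hk.some
        have h2 := congrArg (· ≫ biprod.snd) hg
        ext
        · simpa using h1
        · simpa using h2.symm
      · intro W g hg m hm
        refine Fork.IsLimit.hom_ext hk.some ?_
        rw [Fork.IsLimit.lift_ι]
        have := congrArg (· ≫ biprod.fst) hm
        simpa using this
    · obtain ⟨h, hh⟩ := hf Y hY (g ≫ biprod.fst)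
      refine ⟨biprod.lift h (g ≫ biprod.snd), ?_⟩
      ext <;> simp [hh]

variable {k : Type v} [Field k] [Linear k A]

/-- Adding one object `T` to `𝒴'` preserves the finiteness of the relative resolutions, provided
that the morphisms `Y ⟶ T` with `Y` in `𝒴'` factor through a subobject of `T` which is a finite
direct sum of objects of `𝒴'`, and that `T` has only scalar endomorphisms. -/
theorem HasFiniteApproxDim.insert (𝓜 : ObjectProperty A) {T αT : A} (i : αT ⟶ T) [Mono i]
    (hα : FiniteSum 𝒴' αT) (hi : ∀ Y, 𝒴' Y → ∀ g : Y ⟶ T, ∃ h, h ≫ i = g)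
    (hT : ∀ g : T ⟶ T, ∃ c : k, g = c • 𝟙 T)
    (h𝓜 : ∀ M, 𝓜 M → FiniteDimensional k (T ⟶ M))
    (h𝓜' : ∀ (K C M : A) (i : K ⟶ C) (f : C ⟶ M) (w : i ≫ f = 0),
      Nonempty (IsLimit (KernelFork.ofι i w)) → FiniteSum 𝒴' C → 𝓜 M → 𝓜 K)
    {M : A} (hM : 𝓜 M) (h : HasFiniteApproxDim 𝒴' M) :
    HasFiniteApproxDim (fun Y => 𝒴' Y ∨ Y = T) M := by
  induction h with
  | zero M h => exact .zero M h
  | @step K C M κ f w hk hC hf hK ih =>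
    have hK' := ih (h𝓜' K C M κ f w hk hC hM)
    have := h𝓜 M hM
    -- `R` consists of the maps `T ⟶ M` that already lift to `C`. One copy of `T` is added for each
    -- basis vector of the quotient by `R`, so nothing is added twice.
    let R : Submodule k (T ⟶ M) := LinearMap.range (Linear.rightComp k T f)
    let b := Module.finBasis k ((T ⟶ M) ⧸ R)
    choose e he using fun j => R.mkQ_surjective (b j)
    let J := Fin (Module.finrank k ((T ⟶ M) ⧸ R))
    let W : A := ⨁ fun _ : J => T
    let V : A := ⨁ fun _ : J => αT
    let ι : V ⟶ W := biproduct.map fun _ => i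
    let ε : W ⟶ M := biproduct.desc e
    have hV : FiniteSum 𝒴' V := .biproduct fun _ => hα
    have hle : ∀ Y, 𝒴' Y → 𝒴' Y ∨ Y = T := fun _ => Or.inl
    -- On the subobject `V` of `W` the new maps already lift to `C`; subtracting this lift sends `V`
    -- into the kernel of `f'`.
    obtain ⟨l, hl⟩ := hV.exists_lift f hf (ι ≫ ε)
    have hcomp : ∀ c : J → k, biproduct.lift (fun j => c j • 𝟙 T) ≫ ε = ∑ j, c j • e j := by
      intro c
      simp [ε, biproduct.lift_desc]
    have hsum : ∀ c : J → k, R.mkQ (∑ j, c j • e j) = ∑ j, c j • b j := by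
      intro c
      rw [map_sum]
      exact Finset.sum_congr rfl fun j _ => by rw [map_smul, he]
    let f' : C ⊞ W ⟶ M := biprod.desc f ε
    have hf' : ∀ Y, (𝒴' Y ∨ Y = T) → ∀ g : Y ⟶ M, ∃ h, h ≫ f' = g := by
      rintro Y (hY | rfl) g
      · obtain ⟨h, rfl⟩ := hf Y hY g
        exact ⟨h ≫ biprod.inl, by simp [f']⟩
      · have h1 : R.mkQ (g - ∑ j, b.repr (R.mkQ g) j • e j) = 0 := by
          rw [map_sub, hsum, b.sum_repr, sub_self]
        rw [Submodule.mkQ_apply, Submodule.Quotient.mk_eq_zero] at h1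
        obtain ⟨h, hh⟩ := h1
        refine ⟨biprod.lift h (biproduct.lift fun j => b.repr (R.mkQ g) j • 𝟙 Y), ?_⟩
        rw [biprod.lift_desc, hcomp]
        change h ≫ f = _ at hh
        rw [hh, sub_add_cancel]
    let m : K ⊞ V ⟶ C ⊞ W := biprod.desc (κ ≫ biprod.inl) (ι ≫ biprod.inr - l ≫ biprod.inl)
    have hm : m ≫ f' = 0 := by
      ext
      · simp [m, f', w]
      · simp [m, f', hl]
    let j : K ⊞ V ⟶ kernel f' := kernel.lift f' m hm
    have : Mono κ := ⟨fun _ _ h => Fork.IsLimit.hom_ext hk.some h⟩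
    have : Mono m := by
      refine Preadditive.mono_of_cancel_zero _ fun {Z} g hg => ?_
      have h2 : (g ≫ biprod.snd) ≫ ι = 0 := by
        have := congrArg (· ≫ biprod.snd) hg
        have e1 : m ≫ biprod.snd = biprod.snd ≫ ι := by ext <;> simp [m]
        simpa [e1] using this
      have h2' := zero_of_comp_mono _ h2
      have h1 : (g ≫ biprod.fst) ≫ κ = 0 := by
        have := congrArg (· ≫ biprod.fst) hg
        have e1 : m ≫ biprod.fst = biprod.fst ≫ κ - biprod.snd ≫ l := by ext <;> simp [m]
        simpa [e1, reassoc_of% h2'] using this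
      have h1' := zero_of_comp_mono _ h1
      exact biprod.hom_ext _ _ (by simpa using h1') (by simpa using h2')
    have : Mono j := by
      have : Mono (j ≫ kernel.ι f') := by rw [kernel.lift_ι]; infer_instance
      exact mono_of_mono j (kernel.ι f')
    -- `K ⊞ V` need not be the whole kernel, but it receives every map from the enlarged class,
    -- which suffices by `of_mono`.
    have hj : ∀ Y, (𝒴' Y ∨ Y = T) → ∀ g : Y ⟶ kernel f', ∃ h, h ≫ j = g := by
      intro Y hY g
      let y₁ := g ≫ kernel.ι f' ≫ biprod.fst
      let y₂ := g ≫ kernel.ι f' ≫ biprod.snd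
      have hy : y₁ ≫ f + y₂ ≫ ε = 0 := by
        have h0 := g ≫= kernel.condition f'
        have e1 : kernel.ι f' ≫ f' =
            kernel.ι f' ≫ (biprod.fst ≫ f + biprod.snd ≫ ε) := by
          congr 1
          exact biprod.hom_ext' _ _ (by simp [f']) (by simp [f'])
        rw [e1] at h0
        simpa [y₁, y₂] using h0
      have hz : ∃ z, z ≫ ι = y₂ := by
        rcases hY with hY | rfl
        · choose z hz using fun j => hi Y hY (y₂ ≫ biproduct.π _ j)
          refine ⟨biproduct.lift z, ?_⟩
          refine biproduct.hom_ext _ _ fun j => ?_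
          simp [ι, hz]
        -- A map from `T` to `W` is a vector of scalars. Lying in the kernel makes the corresponding
        -- combination of the `e j` an element of `R`, so independence modulo `R` kills it.
        · choose c hc using fun j => hT (y₂ ≫ biproduct.π _ j)
          have hy₂ : y₂ = biproduct.lift (fun j => c j • 𝟙 Y) :=
            biproduct.hom_ext _ _ fun j => by rw [biproduct.lift_π, hc]
          have h0 : ∑ j, c j • b j = 0 := by
            rw [← hsum, Submodule.mkQ_apply, Submodule.Quotient.mk_eq_zero, ← hcomp, ← hy₂]
            refine ⟨-y₁, ?_⟩
            change (-y₁) ≫ f = _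
            rw [Preadditive.neg_comp]
            exact neg_eq_of_add_eq_zero_right hy
          have hc0 := Fintype.linearIndependent_iff.1 b.linearIndependent c h0
          refine ⟨0, ?_⟩
          rw [hy₂]
          refine biproduct.hom_ext _ _ fun j => ?_
          simp [hc0]
      obtain ⟨z, hz⟩ := hz
      have h1 : (y₁ + z ≫ l) ≫ f = 0 := by
        rw [Preadditive.add_comp, Category.assoc z, hl, ← Category.assoc z, hz, hy]
      refine ⟨biprod.lift (hk.some.lift (KernelFork.ofι _ h1)) z, ?_⟩
      rw [← cancel_mono (kernel.ι f'), Category.assoc, kernel.lift_ι]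
      have h3 : hk.some.lift (KernelFork.ofι _ h1) ≫ κ = y₁ + z ≫ l :=
        Fork.IsLimit.lift_ι hk.some
      refine biprod.hom_ext _ _ ?_ ?_
      · simp [m, biprod.lift_desc, reassoc_of% h3, y₁]
      · simp [m, biprod.lift_desc, hz, y₂]
    exact .step_kernel f' ((hC.mono hle).biprod (.biproduct fun _ => .of_mem (.inr rfl))) hf'
      ((hK'.biprod (hV.mono hle)).of_mono j hj)

end FiniteSums

/-! ### Pointwise exactness. -/

section Exactness

variable {k : Type v} [Field k] {P : Type u} [PartialOrder P]

attribute [local instance] Abelian.hasFiniteBiproducts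

theorem PosetRep.mono_iff {M N : PosetRep k P} (f : M ⟶ N) :
    Mono f ↔ ∀ p, Function.Injective (f.app p).hom := by
  rw [NatTrans.mono_iff_mono_app]
  exact forall_congr' fun p => ModuleCat.mono_iff_injective _

theorem PosetRep.epi_iff {M N : PosetRep k P} (f : M ⟶ N) :
    Epi f ↔ ∀ p, Function.Surjective (f.app p).hom := by
  rw [NatTrans.epi_iff_epi_app]
  exact forall_congr' fun p => ModuleCat.epi_iff_surjective _

theorem PosetRep.exists_of_exact {S : ShortComplex (PosetRep k P)} (hS : S.Exact) (p : P)
    (x : S.X₂.obj p) (hx : (S.g.app p).hom x = 0) : ∃ y, (S.f.app p).hom y = x := by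
  have := hS.map ((evaluation P (ModuleCat.{v} k)).obj p)
  rw [ShortComplex.moduleCat_exact_iff] at this
  exact this x hx

theorem PosetRep.exists_of_isKernel {K M N : PosetRep k P} {i : K ⟶ M} {f : M ⟶ N}
    {w : i ≫ f = 0} (h : IsLimit (KernelFork.ofι i w)) (p : P) (x : M.obj p)
    (hx : (f.app p).hom x = 0) : ∃ y, (i.app p).hom y = x :=
  exists_of_exact (ShortComplex.exact_of_f_is_kernel (.mk i f w) h) p x hx

theorem PosetRep.injective_of_isKernel {K M N : PosetRep k P} {i : K ⟶ M} {f : M ⟶ N}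
    {w : i ≫ f = 0} (h : IsLimit (KernelFork.ofι i w)) (p : P) :
    Function.Injective (i.app p).hom :=
  (mono_iff i).1 ⟨fun _ _ h' => Fork.IsLimit.hom_ext h h'⟩ p

theorem PosetRep.app_app_eq_zero {K M N : PosetRep k P} {i : K ⟶ M} {f : M ⟶ N}
    (w : i ≫ f = 0) (p : P) (x : K.obj p) : (f.app p).hom ((i.app p).hom x) = 0 :=
  congrArg (fun g : K ⟶ N => (g.app p).hom x) w

theorem PosetRep.biproduct_total_apply {J : Type} [Fintype J] (X : J → PosetRep k P) (p : P)
    (x : (⨁ X : PosetRep k P).obj p) :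
    ∑ j, ((biproduct.ι X j).app p).hom (((biproduct.π X j).app p).hom x) = x := by
  have := congrArg (fun g : (⨁ X) ⟶ (⨁ X) => (g.app p).hom x) (biproduct.total (f := X))
  have h2 : ∀ s : Finset J,
      ((∑ j ∈ s, biproduct.π X j ≫ biproduct.ι X j : (⨁ X) ⟶ (⨁ X)).app p).hom x =
      ∑ j ∈ s, ((biproduct.ι X j).app p).hom (((biproduct.π X j).app p).hom x) := by
    classical
    intro s
    induction s using Finset.induction_on with
    | empty => rfl
    | insert a s ha ih => rw [Finset.sum_insert ha, Finset.sum_insert ha, ← ih]; rfl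
  rw [← h2]
  exact this

end Exactness

/-! ### Representations and sets adapted to a finite set of points. -/

section Tame

variable {k : Type v} [Field k] {P : Type u} [PartialOrder P] {G : Finset P}

attribute [local instance] Abelian.hasFiniteBiproducts

/-- Every element of `G` below `p` is below `q`. -/
def FloorLE (G : Finset P) (p q : P) : Prop := ∀ g ∈ G, g ≤ p → g ≤ q

theorem FloorLE.of_le {p q : P} (h : p ≤ q) : FloorLE G p q := fun _ _ hg => hg.trans h

theorem FloorLE.trans {p q r : P} (h : FloorLE G p q) (h' : FloorLE G q r) : FloorLE G p r :=
  fun g hg hp => h' g hg (h g hg hp)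

/-- The elements of `G` below a given element of `P` have a maximum unless there is none. -/
def HasFloors (G : Finset P) : Prop :=
  ∀ p, (∃ g ∈ G, g ≤ p) → ∃ m ∈ G, m ≤ p ∧ FloorLE G p m

/-- The finite-dimensional representations that are determined by their restriction to `G`. -/
structure IsTame (G : Finset P) (M : PosetRep k P) : Prop where
  bijective : ∀ (p q : P) (h : p ⟶ q), FloorLE G q p → Function.Bijective (M.map h).hom
  eq_zero : ∀ p, (∀ g ∈ G, ¬ g ≤ p) → ∀ x : M.obj p, x = 0
  finite : ∀ p, FiniteDimensional k (M.obj p)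

/-- The sets that are determined by their intersection with `G`. -/
structure IsTameSet (G : Finset P) (S : Set P) : Prop where
  mem_iff : ∀ p q, p ≤ q → FloorLE G q p → (p ∈ S ↔ q ∈ S)
  exists_le : ∀ p ∈ S, ∃ g ∈ G, g ≤ p

theorem IsTameSet.exists_floor {S : Set P} (hG : HasFloors G) (h : IsTameSet G S) {p : P}
    (hp : p ∈ S) : ∃ m ∈ G, m ∈ S ∧ m ≤ p ∧ FloorLE G p m := by
  obtain ⟨m, hm, hmp, hpm⟩ := hG p (h.exists_le p hp)
  exact ⟨m, hm, (h.mem_iff m p hmp hpm).2 hp, hmp, hpm⟩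

theorem IsTameSet.isTame {S : Set P} (hS : S.OrdConnected) (h : IsTameSet G S) :
    IsTame G (indicatorRep k S hS) where
  bijective p q a ha := by
    have hpq := h.mem_iff p q (leOfHom a) ha
    by_cases hq : q ∈ S
    · constructor
      · intro x y hxy
        refine indicatorCoeff_injective p ?_
        rw [← indicatorCoeff_map a hq, ← indicatorCoeff_map a hq, hxy]
      · intro y
        refine ⟨indicatorCoeff hS q y • indicatorGen k hS (hpq.2 hq), ?_⟩
        rw [map_smul, indicator_map_gen a (hpq.2 hq) hq, indicatorCoeff_smul_gen]
    · have hp : p ∉ S := fun hp => hq (hpq.1 hp)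
      exact ⟨fun x y _ => (indicator_eq_zero hp x).trans (indicator_eq_zero hp y).symm,
        fun y => ⟨0, (indicator_eq_zero hq _).trans (indicator_eq_zero hq y).symm⟩⟩
  eq_zero p hp x := indicator_eq_zero (fun hpS => by
    obtain ⟨g, hg, hgp⟩ := h.exists_le p hpS
    exact hp g hg hgp) x
  finite p := FiniteDimensional.of_injective (indicatorCoeff hS p) (indicatorCoeff_injective p)

theorem isTameSet_Ici {g : P} (hg : g ∈ G) : IsTameSet G (Set.Ici g) where
  mem_iff _ _ hpq h := ⟨fun hp => le_trans hp hpq, fun hq => h g hg hq⟩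
  exists_le _ hp := ⟨g, hg, hp⟩

/-- This keeps all syzygies over the same `G`, so one finite family of spreads serves for the entire
resolution. -/
theorem IsTame.of_isKernel {K M N : PosetRep k P} (hM : IsTame G M) (hN : IsTame G N) {i : K ⟶ M}
    {f : M ⟶ N} {w : i ≫ f = 0} (h : IsLimit (KernelFork.ofι i w)) : IsTame G K where
  bijective p q a ha := by
    have hi := PosetRep.injective_of_isKernel h
    constructor
    · intro x y hxy
      refine hi p ((hM.bijective p q a ha).1 ?_)
      rw [← PosetRep.naturality, ← PosetRep.naturality, hxy]
    · intro y
      obtain ⟨x, hx⟩ := (hM.bijective p q a ha).2 ((i.app q).hom y)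
      have hfx : (f.app p).hom x = 0 := by
        refine (hN.bijective p q a ha).1 ?_
        rw [← PosetRep.naturality, hx, PosetRep.app_app_eq_zero w, map_zero]
      obtain ⟨z, rfl⟩ := PosetRep.exists_of_isKernel h p x hfx
      refine ⟨z, hi q ?_⟩
      rw [PosetRep.naturality, hx]
  eq_zero p hp x := PosetRep.injective_of_isKernel h p
    ((hM.eq_zero p hp _).trans (hM.eq_zero p hp _).symm)
  finite p :=
    have := hM.finite p
    FiniteDimensional.of_injective (i.app p).hom (PosetRep.injective_of_isKernel h p)

theorem IsTame.of_isCokernel {M N Q : PosetRep k P} (hM : IsTame G M) (hN : IsTame G N) {f : M ⟶ N}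
    {π : N ⟶ Q} {w : f ≫ π = 0} (h : IsColimit (CokernelCofork.ofπ π w)) : IsTame G Q := by
  have hπ : ∀ p, Function.Surjective (π.app p).hom :=
    (PosetRep.epi_iff π).1 ⟨fun _ _ h' => Cofork.IsColimit.hom_ext h h'⟩
  have hex := PosetRep.exists_of_exact (ShortComplex.exact_of_g_is_cokernel (.mk f π w) h)
  refine ⟨fun p q a ha => ⟨?_, ?_⟩, ?_, fun p => ?_⟩
  · rw [injective_iff_map_eq_zero]
    intro x hx
    obtain ⟨y, rfl⟩ := hπ p x
    rw [← PosetRep.naturality] at hx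
    obtain ⟨z, hz⟩ := hex q _ hx
    obtain ⟨z', rfl⟩ := (hM.bijective p q a ha).2 z
    have : (f.app p).hom z' = y := by
      refine (hN.bijective p q a ha).1 ?_
      rw [← PosetRep.naturality]
      exact hz
    rw [← this]
    exact PosetRep.app_app_eq_zero w p z'
  · intro x
    obtain ⟨y, rfl⟩ := hπ q x
    obtain ⟨z, rfl⟩ := (hN.bijective p q a ha).2 y
    exact ⟨(π.app p).hom z, (PosetRep.naturality _ _ _).symm⟩
  · intro p hp x
    obtain ⟨y, rfl⟩ := hπ p x
    rw [hN.eq_zero p hp y, map_zero]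
  · have := hN.finite p
    exact Module.Finite.of_surjective (π.app p).hom (hπ p)

theorem IsTame.of_iso {M N : PosetRep k P} (e : M ≅ N) (hM : IsTame G M) : IsTame G N := by
  refine hM.of_isKernel hM (i := e.inv) (f := 0) (w := comp_zero) ?_
  exact KernelFork.IsLimit.ofι _ _ (fun g _ => g ≫ e.hom) (by simp) (by
    intro W g _ m hm
    rw [← hm]
    simp)

theorem IsTame.biproduct {J : Type} [Fintype J] {X : J → PosetRep k P}
    (h : ∀ j, IsTame G (X j)) : IsTame G (⨁ X) where
  bijective p q a ha := by
    constructor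
    · intro x y hxy
      rw [← PosetRep.biproduct_total_apply X p x, ← PosetRep.biproduct_total_apply X p y]
      refine Finset.sum_congr rfl fun j _ => congrArg _ ?_
      refine ((h j).bijective p q a ha).1 ?_
      rw [← PosetRep.naturality, ← PosetRep.naturality, hxy]
    · intro y
      choose x hx using fun j => ((h j).bijective p q a ha).2 (((biproduct.π X j).app q).hom y)
      refine ⟨∑ j, ((biproduct.ι X j).app p).hom (x j), ?_⟩
      rw [map_sum]
      refine Eq.trans (Finset.sum_congr rfl fun j _ => ?_) (PosetRep.biproduct_total_apply X q y)
      rw [← PosetRep.naturality, hx]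
  eq_zero p hp x := by
    rw [← PosetRep.biproduct_total_apply X p x]
    refine Finset.sum_eq_zero fun j _ => ?_
    rw [(h j).eq_zero p hp (((biproduct.π X j).app p).hom x), map_zero]
  finite p := by
    have := fun j => (h j).finite p
    refine FiniteDimensional.of_injective (LinearMap.pi fun j => ((biproduct.π X j).app p).hom)
      fun x y hxy => ?_
    rw [← PosetRep.biproduct_total_apply X p x, ← PosetRep.biproduct_total_apply X p y]
    exact Finset.sum_congr rfl fun j _ => congrArg _ (congrFun hxy j)

theorem FiniteSum.isTame {𝒴 : ObjectProperty (PosetRep k P)} (h𝒴 : ∀ Y, 𝒴 Y → IsTame G Y)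
    {M : PosetRep k P} (hM : FiniteSum 𝒴 M) : IsTame G M := by
  obtain ⟨J, _, X, hX, ⟨e⟩⟩ := hM
  exact (IsTame.biproduct fun j => h𝒴 _ (hX j)).of_iso e.symm

/-- The morphisms from an indicator representation of a tame set are determined by finitely many
values. -/
theorem IsTame.finiteDimensional_hom {M : PosetRep k P} (hG : HasFloors G) (hM : IsTame G M)
    {S : Set P} (hS : S.OrdConnected) (hSG : IsTameSet G S) :
    FiniteDimensional k (indicatorRep k S hS ⟶ M) := by
  have := hM.finite
  let φ : (indicatorRep k S hS ⟶ M) →ₗ[k] ∀ g : {g : G // (g : P) ∈ S}, M.obj g.1 :=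
    { toFun f g := indicatorImage f g.2
      map_add' f f' := rfl
      map_smul' c f := rfl }
  refine FiniteDimensional.of_injective φ fun f f' hff' => indicatorRep_hom_ext fun p hp => ?_
  obtain ⟨m, hm, hmS, hmp, -⟩ := hSG.exists_floor hG hp
  rw [← map_indicatorImage f (homOfLE hmp) hmS hp, ← map_indicatorImage f' (homOfLE hmp) hmS hp]
  exact congrArg _ (congrFun hff' ⟨⟨m, hm⟩, hmS⟩)

end Tame

/-! ### Tame representations are finitely presented. -/

section FinitelyPresented

variable {k : Type v} [Field k] {P : Type u} [PartialOrder P] {G : Finset P}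

attribute [local instance] Abelian.hasFiniteBiproducts

theorem exists_upsetRep_hom {M : PosetRep k P} (p : P) (x : M.obj p) :
    ∃ f : upsetRep k p ⟶ M, indicatorImage f (Set.self_mem_Ici (a := p)) = x := by
  obtain ⟨f, hf⟩ := exists_indicatorDesc Set.ordConnected_Ici M
    (fun q (hq : q ∈ Set.Ici p) => (M.map (homOfLE hq)).hom x)
    (fun q r h hq hr => PosetRep.map_map _ _ _ _)
    (fun q r h hq hr => absurd (le_trans hq (leOfHom h)) hr)
  exact ⟨f, (hf p _).trans (PosetRep.map_self _ _ _)⟩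

/-- Each value is either zero or transported isomorphically from the floor of the point, so bases of
the values on `G` generate `M`. -/
theorem IsTame.exists_epi {M : PosetRep k P} (hG : HasFloors G) (hM : IsTame G M) :
    ∃ (n : ℕ) (b : Fin n → P) (_ : ∀ j, b j ∈ G) (f : (∐ fun j => upsetRep k (b j)) ⟶ M),
      Epi f := by
  have := hM.finite
  let ι := Σ g : G, Fin (Module.finrank k (M.obj g))
  let e := Fintype.equivFin ι
  let x : ∀ i : ι, M.obj i.1 := fun i => Module.finBasis k (M.obj i.1) i.2
  choose φ hφ using fun i : ι => exists_upsetRep_hom (M := M) (i.1 : P) (x i)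
  refine ⟨Fintype.card ι, fun j => (e.symm j).1, fun j => (e.symm j).1.2,
    Sigma.desc fun j => φ (e.symm j), ?_⟩
  rw [PosetRep.epi_iff]
  set F := Sigma.desc fun j => φ (e.symm j) with hF
  have hmem : ∀ i : ι, x i ∈ LinearMap.range (F.app i.1).hom := by
    intro i
    obtain ⟨j, rfl⟩ := e.symm.surjective i
    refine ⟨((Sigma.ι (fun j => upsetRep k ((e.symm j).1 : P)) j).app _).hom
      (indicatorGen k Set.ordConnected_Ici Set.self_mem_Ici), ?_⟩
    have h1 : Sigma.ι (fun j => upsetRep k ((e.symm j).1 : P)) j ≫ F = φ (e.symm j) :=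
      Sigma.ι_desc _ _
    rw [← hφ, ← h1]
    rfl
  intro p y
  by_cases hp : ∃ g ∈ G, g ≤ p
  · obtain ⟨m, hm, hmp, hpm⟩ := hG p hp
    obtain ⟨z, rfl⟩ := (hM.bijective m p (homOfLE hmp) hpm).2 y
    have hz : z ∈ LinearMap.range (F.app m).hom := by
      rw [← (Module.finBasis k (M.obj m)).sum_repr z]
      exact Submodule.sum_mem _ fun i _ => Submodule.smul_mem _ _ (hmem ⟨⟨m, hm⟩, i⟩)
    obtain ⟨z', rfl⟩ := hz
    exact ⟨((∐ fun j => upsetRep k ((e.symm j).1 : P)).map (homOfLE hmp)).hom z',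
      PosetRep.naturality _ _ _⟩
  · push Not at hp
    exact ⟨0, by rw [map_zero, hM.eq_zero p hp y]⟩

theorem isTame_sigma_upsetRep {n : ℕ} {b : Fin n → P} (hb : ∀ j, b j ∈ G) :
    IsTame G (∐ fun j => upsetRep k (b j)) :=
  (IsTame.biproduct fun j => (isTameSet_Ici (hb j)).isTame
    (k := k) Set.ordConnected_Ici).of_iso (biproduct.isoCoproduct _)

/-- The kernel of a cover by upset representations is tame again; covering it gives the relations.
-/
theorem IsTame.isFinitelyPresentedRep {M : PosetRep k P} (hG : HasFloors G) (hM : IsTame G M) :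
    isFinitelyPresentedRep k P M := by
  obtain ⟨n, b, hb, f, hf⟩ := hM.exists_epi hG
  have hK : IsTame G (kernel f) := (isTame_sigma_upsetRep hb).of_isKernel hM
    (w := kernel.condition f) (kernelIsKernel f)
  obtain ⟨m, a, -, g, hg⟩ := hK.exists_epi hG
  refine ⟨m, n, a, b, g ≫ kernel.ι f, ⟨?_⟩⟩
  refine IsColimit.coconePointUniqueUpToIso
    (isCokernelEpiComp (Abelian.epiIsCokernelOfKernel _ (kernelIsKernel f)) g rfl)
    (colimit.isColimit _)

end FinitelyPresented

/-! ### Grids spanned by finite sets of coordinates. -/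

section Grid

variable {k : Type v} [Field k] {n : ℕ} {T : Fin n → Type u} [∀ i, LinearOrder (T i)]

theorem hasFloors_piFinset (H : ∀ i, Finset (T i)) : HasFloors (Fintype.piFinset H) := by
  rintro p ⟨g, hg, hgp⟩
  rw [Fintype.mem_piFinset] at hg
  have hne : ∀ i, ((H i).filter (· ≤ p i)).Nonempty := fun i =>
    ⟨g i, Finset.mem_filter.2 ⟨hg i, hgp i⟩⟩
  have hmem := fun i => Finset.mem_filter.1 (Finset.max'_mem _ (hne i))
  refine ⟨fun i => ((H i).filter (· ≤ p i)).max' (hne i), ?_, fun i => (hmem i).2, ?_⟩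
  · exact Fintype.mem_piFinset.2 fun i => (hmem i).1
  · intro g' hg' hg'p i
    exact Finset.le_max' _ _ (Finset.mem_filter.2 ⟨Fintype.mem_piFinset.1 hg' i, hg'p i⟩)

theorem exists_isTame_of_isFinitelyPresentedRep {M : PosetRep k (∀ i, T i)}
    (hM : isFinitelyPresentedRep k (∀ i, T i) M) :
    ∃ H : ∀ i, Finset (T i), IsTame (Fintype.piFinset H) M := by
  obtain ⟨m, n, a, b, f, ⟨e⟩⟩ := hM
  let H : ∀ i, Finset (T i) := fun i =>
    Finset.univ.image (fun j => a j i) ∪ Finset.univ.image (fun j => b j i)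
  have ha : ∀ j, a j ∈ Fintype.piFinset H := fun j => Fintype.mem_piFinset.2 fun i =>
    Finset.mem_union_left _ (Finset.mem_image_of_mem _ (Finset.mem_univ j))
  have hb : ∀ j, b j ∈ Fintype.piFinset H := fun j => Fintype.mem_piFinset.2 fun i =>
    Finset.mem_union_right _ (Finset.mem_image_of_mem _ (Finset.mem_univ j))
  exact ⟨H, ((isTame_sigma_upsetRep ha).of_isCokernel (isTame_sigma_upsetRep hb)
    (w := cokernel.condition f) (cokernelIsCokernel f)).of_iso e.symm⟩

end Grid

/-! ### Splitting convex sets into connected components. -/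

section Components

variable {k : Type v} [Field k] {P : Type u} [PartialOrder P] {G : Finset P}

attribute [local instance] Abelian.hasFiniteBiproducts

/-- The indicator representation of a disjoint union of two sets without comparabilities between
them is a direct sum. -/
theorem nonempty_indicatorRep_iso_biprod {S S₁ S₂ : Set P} (hS : S.OrdConnected)
    (hS₁ : S₁.OrdConnected) (hS₂ : S₂.OrdConnected) (hunion : ∀ p, p ∈ S ↔ p ∈ S₁ ∨ p ∈ S₂)
    (hdisj : ∀ p q, p ∈ S₁ → q ∈ S₂ → ¬ p ≤ q ∧ ¬ q ≤ p) :
    Nonempty (indicatorRep k S hS ≅ indicatorRep k S₁ hS₁ ⊞ indicatorRep k S₂ hS₂) := by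
  have hd : ∀ p, p ∈ S₁ → p ∉ S₂ := fun p h₁ h₂ => (hdisj p p h₁ h₂).1 le_rfl
  have h₁ : ∀ p q, p ≤ q → (p ∈ S₁ ∧ q ∈ S ∨ p ∈ S ∧ q ∈ S₁) → p ∈ S₁ ∧ q ∈ S₁ := by
    rintro p q hpq (⟨hp, hq⟩ | ⟨hp, hq⟩)
    · exact ⟨hp, ((hunion q).1 hq).resolve_right fun hq' => (hdisj p q hp hq').1 hpq⟩
    · exact ⟨((hunion p).1 hp).resolve_right fun hp' => (hdisj q p hq hp').2 hpq, hq⟩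
  have h₂ : ∀ p q, p ≤ q → (p ∈ S₂ ∧ q ∈ S ∨ p ∈ S ∧ q ∈ S₂) → p ∈ S₂ ∧ q ∈ S₂ := by
    rintro p q hpq (⟨hp, hq⟩ | ⟨hp, hq⟩)
    · exact ⟨hp, ((hunion q).1 hq).resolve_left fun hq' => (hdisj q p hq' hp).2 hpq⟩
    · exact ⟨((hunion p).1 hp).resolve_left fun hp' => (hdisj p q hp' hq).1 hpq, hq⟩
  have hl : ∀ p, p ∈ S₁ → p ∈ S := fun p hp => (hunion p).2 (.inl hp)
  have hr : ∀ p, p ∈ S₂ → p ∈ S := fun p hp => (hunion p).2 (.inr hp)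
  obtain ⟨i₁, hi₁⟩ := exists_indicatorHom k hS₁ hS fun p q hpq hp hq =>
    ⟨fun _ => hl p hp, fun _ => (h₁ p q hpq (.inl ⟨hp, hq⟩)).2⟩
  obtain ⟨i₂, hi₂⟩ := exists_indicatorHom k hS₂ hS fun p q hpq hp hq =>
    ⟨fun _ => hr p hp, fun _ => (h₂ p q hpq (.inl ⟨hp, hq⟩)).2⟩
  obtain ⟨π₁, hπ₁⟩ := exists_indicatorHom k hS hS₁ fun p q hpq hp hq =>
    ⟨fun _ => (h₁ p q hpq (.inr ⟨hp, hq⟩)).1, fun _ => hl q hq⟩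
  obtain ⟨π₂, hπ₂⟩ := exists_indicatorHom k hS hS₂ fun p q hpq hp hq =>
    ⟨fun _ => (h₂ p q hpq (.inr ⟨hp, hq⟩)).1, fun _ => hr q hq⟩
  have z₁ : ∀ p, p ∈ S₂ → ∀ x : (indicatorRep k S₁ hS₁).obj p, x = 0 := fun p hp x =>
    indicator_eq_zero (fun h => hd p h hp) x
  have z₂ : ∀ p, p ∈ S₁ → ∀ x : (indicatorRep k S₂ hS₂).obj p, x = 0 := fun p hp x =>
    indicator_eq_zero (hd p hp) x
  have total : π₁ ≫ i₁ + π₂ ≫ i₂ = 𝟙 (indicatorRep k S hS) := by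
    refine indicatorRep_hom_ext fun p hp => ?_
    rw [indicatorImage_add, indicatorImage_comp, indicatorImage_comp, indicatorImage_id]
    rcases (hunion p).1 hp with hp' | hp'
    · rw [z₂ p hp' (indicatorImage π₂ hp), map_zero, add_zero, hπ₁ p hp hp']
      exact hi₁ p hp' hp
    · rw [z₁ p hp' (indicatorImage π₁ hp), map_zero, zero_add, hπ₂ p hp hp']
      exact hi₂ p hp' hp
  exact ⟨biprod.uniqueUpToIso _ _ (isBinaryBilimitOfTotal
    { pt := indicatorRep k S hS
      fst := π₁
      snd := π₂
      inl := i₁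
      inr := i₂
      inl_fst := indicatorRep_hom_ext fun p hp => by
        rw [indicatorImage_comp, hi₁ p hp (hl p hp)]
        exact hπ₁ p (hl p hp) hp
      inl_snd := indicatorRep_hom_ext fun p hp => (z₂ p hp _).trans (z₂ p hp _).symm
      inr_fst := indicatorRep_hom_ext fun p hp => (z₁ p hp _).trans (z₁ p hp _).symm
      inr_snd := indicatorRep_hom_ext fun p hp => by
        rw [indicatorImage_comp, hi₂ p hp (hr p hp)]
        exact hπ₂ p (hr p hp) hp } total)⟩

/-- The representations of the tame spreads with the property `p`. -/
def tameSpreadRep (k : Type v) [Field k] (G : Finset P) (p : Set P → Prop) :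
    ObjectProperty (PosetRep k P) := fun Y =>
  ∃ (S : Set P) (hS : IsSpread S), IsTameSet G S ∧ p S ∧ Y = indicatorRep k S hS.ordConnected

theorem tameSpreadRep.isTame {q : Set P → Prop} {Y : PosetRep k P}
    (hY : tameSpreadRep k G q Y) : IsTame G Y := by
  obtain ⟨S, hS, hSG, -, rfl⟩ := hY
  exact hSG.isTame _

/-- The indicator representation of a tame convex set is the direct sum of those of its connected
components. -/
theorem IsTameSet.finiteSum (hG : HasFloors G) {S : Set P} (hS : S.OrdConnected)
    (h : IsTameSet G S) :
    FiniteSum (tameSpreadRep k G (· ⊆ S)) (indicatorRep k S hS) := by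
  -- The component of `s` is tame, so it contains the floor of one of its points; splitting it off
  -- lowers the number of points of `G`.
  induction hN : ((G : Set P) ∩ S).ncard using Nat.strong_induction_on generalizing S with
  | _ N ih =>
  rcases S.eq_empty_or_nonempty with rfl | ⟨s, hs⟩
  · refine FiniteSum.of_isZero ((IsZero.iff_id_eq_zero _).2 ?_)
    exact indicatorRep_hom_ext fun p hp => absurd hp (Set.notMem_empty p)
  · let R : P → P → Prop := fun a b => a ∈ S ∧ b ∈ S ∧ (a ≤ b ∨ b ≤ a)
    let S₁ : Set P := {t | t ∈ S ∧ Relation.ReflTransGen R s t}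
    let S₂ : Set P := S \ S₁
    have hstep : ∀ a b, a ∈ S₁ → b ∈ S → (a ≤ b ∨ b ≤ a) → b ∈ S₁ := fun a b ha hb hab =>
      ⟨hb, ha.2.tail ⟨ha.1, hb, hab⟩⟩
    have hstep₂ : ∀ a b, a ∈ S₂ → b ∈ S → (a ≤ b ∨ b ≤ a) → b ∈ S₂ := fun a b ha hb hab =>
      ⟨hb, fun hb₁ => ha.2 (hstep b a hb₁ ha.1 hab.symm)⟩
    have hord₁ : S₁.OrdConnected := ⟨fun a ha b hb p hp =>
      hstep a p ha (hS.out ha.1 hb.1 hp) (.inl hp.1)⟩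
    have hord₂ : S₂.OrdConnected := ⟨fun a ha b hb p hp =>
      hstep₂ a p ha (hS.out ha.1 hb.1 hp) (.inl hp.1)⟩
    have htame : ∀ S' : Set P, S' ⊆ S → (∀ a b, a ∈ S' → b ∈ S → (a ≤ b ∨ b ≤ a) → b ∈ S') →
        IsTameSet G S' := fun S' hsub hS' =>
      ⟨fun p q hpq hq => ⟨fun hp => hS' p q hp ((h.mem_iff p q hpq hq).1 (hsub hp)) (.inl hpq),
        fun hq' => hS' q p hq' ((h.mem_iff p q hpq hq).2 (hsub hq')) (.inr hpq)⟩,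
        fun p hp => h.exists_le p (hsub hp)⟩
    have hsub₁ : S₁ ⊆ S := fun p hp => hp.1
    have hsub₂ : S₂ ⊆ S := fun p hp => hp.1
    have hs₁ : s ∈ S₁ := ⟨hs, .refl⟩
    have hpath : ∀ t, Relation.ReflTransGen R s t →
        Relation.ReflTransGen (fun a b => a ∈ S₁ ∧ b ∈ S₁ ∧ (a ≤ b ∨ b ≤ a)) s t := by
      intro t ht
      induction ht with
      | refl => exact .refl
      | tail hab hbc ih =>
        exact ih.tail ⟨⟨hbc.1, hab⟩, ⟨hbc.2.1, hab.tail hbc⟩, hbc.2.2⟩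
    have hspread : IsSpread S₁ :=
      { ordConnected := hord₁
        nonempty := ⟨s, hs₁⟩
        zigzag := fun a ha b hb => by
          refine Relation.ReflTransGen.trans ?_ (hpath b hb.2)
          have : Std.Symm (fun a b => a ∈ S₁ ∧ b ∈ S₁ ∧ (a ≤ b ∨ b ≤ a)) :=
            ⟨fun x y hxy => ⟨hxy.2.1, hxy.1, hxy.2.2.symm⟩⟩
          exact Std.Symm.symm _ _ (hpath a ha.2) }
    obtain ⟨e⟩ := nonempty_indicatorRep_iso_biprod (k := k) hS hord₁ hord₂
      (fun p => ⟨fun hp => (Classical.em (p ∈ S₁)).imp id fun hp' => ⟨hp, hp'⟩,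
        fun hp => hp.elim (fun hp => hsub₁ hp) fun hp => hsub₂ hp⟩)
      (fun p q hp hq => ⟨fun hpq => hq.2 (hstep p q hp hq.1 (.inl hpq)),
        fun hqp => hq.2 (hstep p q hp hq.1 (.inr hqp))⟩)
    refine FiniteSum.of_iso e.symm (.biprod (.of_mem ?_) ?_)
    · exact ⟨S₁, hspread, htame S₁ hsub₁ hstep, hsub₁, rfl⟩
    · have hS₂ := htame S₂ hsub₂ hstep₂
      obtain ⟨m, hm, hmS, -⟩ := (htame S₁ hsub₁ hstep).exists_floor hG hs₁
      refine FiniteSum.mono ?_ (ih _ ?_ hord₂ hS₂ rfl)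
      · rintro Y ⟨S', hS', hS'G, hS'sub, rfl⟩
        exact ⟨S', hS', hS'G, hS'sub.trans hsub₂, rfl⟩
      · rw [← hN]
        refine Set.ncard_lt_ncard ⟨fun g hg => ⟨hg.1, hsub₂ hg.2⟩, fun hsub => ?_⟩
          (G.finite_toSet.inter_of_left _)
        exact (hsub ⟨hm, hsub₁ hmS⟩).2.2 hmS

end Components

/-! ### Ordering the tame spreads; finite dimension of tame representations. -/

section FiniteDimension

variable {k : Type v} [Field k] {P : Type u} [PartialOrder P] {G : Finset P}

/-- There is a morphism from the indicator representation of `S` to that of `T` which does not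
vanish at `p`. -/
def IndicatorHomNonzeroAt (k : Type v) [Field k] (p : P) (S T : Set P) : Prop :=
  ∃ (hS : S.OrdConnected) (hT : T.OrdConnected) (f : indicatorRep k S hS ⟶ indicatorRep k T hT)
    (x : (indicatorRep k S hS).obj p), (f.app p).hom x ≠ 0

/-- The values at `p` have dimension at most one, so composites of maps nonzero at `p` are nonzero
at `p`. Transitivity fails for mere existence of nonzero maps, hence the fixed `p`. -/
theorem IndicatorHomNonzeroAt.trans {p : P} {S T R : Set P} (h : IndicatorHomNonzeroAt k p S T)
    (h' : IndicatorHomNonzeroAt k p T R) : IndicatorHomNonzeroAt k p S R := by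
  obtain ⟨hS, hT, f, x, hx⟩ := h
  obtain ⟨_, hR, g, y, hy⟩ := h'
  have hp : p ∈ T := by
    by_contra hp
    exact hx (indicator_eq_zero hp _)
  refine ⟨hS, hR, f ≫ g, x, ?_⟩
  change (g.app p).hom ((f.app p).hom x) ≠ 0
  rw [app_eq_smul_indicatorImage g hp] at hy ⊢
  refine smul_ne_zero (fun h0 => hx (indicatorCoeff_injective p ?_)) (right_ne_zero_of_smul hy)
  rw [h0, map_zero]

/-- The composite endomorphism is a scalar, nonzero because it is so at `p`; hence it vanishes
nowhere on `S`, yet it factors through `T`. This gives antisymmetry of the order on spreads. -/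
theorem IndicatorHomNonzeroAt.subset {p : P} {S T : Set P} (hS : IsSpread S)
    (h : IndicatorHomNonzeroAt k p S T) (h' : IndicatorHomNonzeroAt k p T S) : S ⊆ T := by
  obtain ⟨_, hT, f, x, hx⟩ := h
  obtain ⟨_, _, g, y, hy⟩ := h'
  have hpT : p ∈ T := by
    by_contra hp
    exact hx (indicator_eq_zero hp _)
  obtain ⟨c, hc⟩ := exists_eq_smul_id hS (f ≫ g)
  have happ : ∀ q (z : (indicatorRep k S hS.ordConnected).obj q),
      (g.app q).hom ((f.app q).hom z) = c • z := fun q z =>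
    congrArg (fun φ : indicatorRep k S hS.ordConnected ⟶ indicatorRep k S hS.ordConnected =>
      (φ.app q).hom z) hc
  have hc0 : c ≠ 0 := by
    rintro rfl
    have := happ p x
    rw [zero_smul, app_eq_smul_indicatorImage g hpT] at this
    rw [app_eq_smul_indicatorImage g hpT] at hy
    rcases smul_eq_zero.1 this with h0 | h0
    · exact hx (indicatorCoeff_injective p (h0.trans (map_zero _).symm))
    · exact right_ne_zero_of_smul hy h0
  intro s hs
  by_contra hsT
  have := happ s (indicatorGen k _ hs)
  rw [indicator_eq_zero hsT ((f.app s).hom _), map_zero] at this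
  exact smul_ne_zero hc0 (indicatorGen_ne_zero hs) this.symm

open Classical in
theorem finite_setOf_isTameSet (hG : HasFloors G) : {S : Set P | IsTameSet G S}.Finite := by
  refine Set.Finite.of_injOn (f := fun S => G.filter (· ∈ S)) (t := (G.powerset : Set (Finset P)))
    (fun S _ => Finset.mem_coe.2 (Finset.mem_powerset.2 (Finset.filter_subset _ _)))
    ?_ (Finset.finite_toSet _)
  have key : ∀ S T : Set P, IsTameSet G S → IsTameSet G T →
      G.filter (· ∈ S) = G.filter (· ∈ T) → S ⊆ T := by
    intro S T hS hT hST p hp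
    obtain ⟨m, hm, hmS, hmp, hpm⟩ := hS.exists_floor hG hp
    have : m ∈ G.filter (· ∈ T) := hST ▸ Finset.mem_filter.2 ⟨hm, hmS⟩
    exact (hT.mem_iff m p hmp hpm).1 (Finset.mem_filter.1 this).2
  exact fun S hS T hT hST => (key S T hS hT hST).antisymm (key T S hT hS hST.symm)

/-- The radical of the indicator representation of a tame spread at a minimal element `p`. -/
theorem exists_mono_of_minimal (hG : HasFloors G) {T : Set P} (hT : T.OrdConnected)
    (hTG : IsTameSet G T) {p : P} (hpG : p ∈ G) (hp : ∀ g ∈ G, g ∈ T → g ≤ p → g = p) :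
    ∃ (αT : PosetRep k P) (i : αT ⟶ indicatorRep k T hT), Mono i ∧
      FiniteSum (tameSpreadRep k G (fun S => S ⊆ T ∧ p ∉ S)) αT ∧
      ∀ (Y : PosetRep k P) (g : Y ⟶ indicatorRep k T hT), IsTame G Y →
        (∀ x, (g.app p).hom x = 0) → ∃ h, h ≫ i = g := by
  -- `T` without the cell of `p`. By minimality of `p`, a point of `T` below that cell has floor `p`
  -- and lies in the cell itself, so `T'` is closed upwards in `T`.
  let T' : Set P := {q | q ∈ T ∧ ¬ (p ≤ q ∧ FloorLE G q p)}
  have hup : ∀ a q, a ≤ q → a ∈ T' → q ∈ T → q ∈ T' := by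
    rintro a q haq ⟨haT, ha⟩ hq
    refine ⟨hq, fun hpq => ha ?_⟩
    have hap : FloorLE G a p := (FloorLE.of_le haq).trans hpq.2
    obtain ⟨m, hm, hmT, hma, -⟩ := hTG.exists_floor hG haT
    obtain rfl := hp m hm hmT (hap m hm hma)
    exact ⟨hma, hap⟩
  have hT' : T'.OrdConnected := ⟨fun a ha b hb q hq => hup a q hq.1 ha (hT.out ha.1 hb.1 hq)⟩
  have hT'G : IsTameSet G T' :=
    { mem_iff := fun a b hab hba => by
        refine and_congr (hTG.mem_iff a b hab hba) (not_congr ⟨fun h => ?_, fun h => ?_⟩)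
        · exact ⟨h.1.trans hab, hba.trans h.2⟩
        · exact ⟨hba p hpG h.1, (FloorLE.of_le hab).trans h.2⟩
      exists_le := fun a ha => hTG.exists_le a ha.1 }
  obtain ⟨i, hi, hlift⟩ := exists_mono_indicatorRep k hT' hT (fun q hq => hq.1)
    (fun a q haq ha hq => hup a q haq ha hq)
  refine ⟨_, i, hi, (hT'G.finiteSum hG hT').mono ?_, fun Y g hY hg => hlift Y g fun q hq x => ?_⟩
  · rintro Y ⟨S, hS, hSG, hST, rfl⟩
    exact ⟨S, hS, hSG, ⟨fun q hq => (hST hq).1, fun hpS => (hST hpS).2 ⟨le_rfl, .of_le le_rfl⟩⟩,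
      rfl⟩
  · by_cases hqT : q ∈ T
    · have hq' : p ≤ q ∧ FloorLE G q p := by
        by_contra h
        exact hq ⟨hqT, h⟩
      obtain ⟨z, rfl⟩ := (hY.bijective p q (homOfLE hq'.1) hq'.2).2 x
      rw [PosetRep.naturality, hg, map_zero]
    · exact indicator_eq_zero hqT _

open Classical in
theorem IsTame.hasFiniteApproxDim_union (hG : HasFloors G) {M : PosetRep k P} (hM : IsTame G M)
    {D : Finset P} (hDG : D ⊆ G) {p : P} (hpD : Minimal (· ∈ D) p)
    (h : HasFiniteApproxDim (tameSpreadRep k G (fun S => ∀ g ∈ G, g ∈ S → g ∈ D.erase p)) M)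
    (𝒲 : Finset (Set P))
    (h𝒲 : ∀ S ∈ 𝒲, IsSpread S ∧ IsTameSet G S ∧ ∀ g ∈ G, g ∈ S → g ∈ D) :
    HasFiniteApproxDim (tameSpreadRep k G
      (fun S => (∀ g ∈ G, g ∈ S → g ∈ D.erase p) ∨ S ∈ 𝒲)) M := by
  induction hN : 𝒲.card generalizing 𝒲 with
  | zero =>
    rw [Finset.card_eq_zero] at hN
    subst hN
    simpa using h
  | succ N ih =>
    let r : 𝒲 → 𝒲 → Prop := fun S T => S ≠ T ∧ IndicatorHomNonzeroAt k p S T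
    have : IsTrans 𝒲 r := ⟨fun S T R h h' => ⟨fun hSR => h.1 (Subtype.ext
      ((h.2.subset (h𝒲 _ S.2).1 (hSR ▸ h'.2)).antisymm
        (IndicatorHomNonzeroAt.subset (h𝒲 _ T.2).1 (hSR ▸ h'.2) h.2))), h.2.trans h'.2⟩⟩
    have : Std.Irrefl r := ⟨fun S h => h.1 rfl⟩
    have hne : 𝒲.Nonempty := Finset.card_pos.1 (by omega)
    -- The spread added last receives from the others in `𝒲` only maps that vanish at `p`.
    obtain ⟨⟨T, hT𝒲⟩, -, hmin⟩ := (Finite.wellFounded_of_trans_of_irrefl r).has_min Set.univ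
      ⟨⟨_, hne.choose_spec⟩, trivial⟩
    obtain ⟨hT, hTG, hTD⟩ := h𝒲 T hT𝒲
    have ih' := ih (𝒲.erase T) (fun S hS => h𝒲 S (Finset.mem_of_mem_erase hS))
      (by rw [Finset.card_erase_of_mem hT𝒲, hN]; rfl)
    obtain ⟨αT, i, hi, hαT, hlift⟩ := exists_mono_of_minimal (k := k) hG hT.ordConnected hTG
      (hDG hpD.1) (fun g hg hgT hgp => le_antisymm hgp (hpD.2 (hTD g hg hgT) hgp))
    have key := HasFiniteApproxDim.insert (k := k) (IsTame G) i (hαT.mono ?_) ?_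
      (exists_eq_smul_id hT) (fun M hM => hM.finiteDimensional_hom hG hT.ordConnected hTG)
      (fun K C M i f w hw hC hM => (hC.isTame fun _ hY => hY.isTame).of_isKernel hM hw.some) hM ih'
    · convert key using 1
      funext Y
      refine propext ⟨?_, ?_⟩
      · rintro ⟨S, hS, hSG, hSD | hS𝒲, rfl⟩
        · exact .inl ⟨S, hS, hSG, .inl hSD, rfl⟩
        · by_cases hST : S = T
          · subst hST
            exact .inr rfl
          · exact .inl ⟨S, hS, hSG, .inr (Finset.mem_erase.2 ⟨hST, hS𝒲⟩), rfl⟩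
      · rintro (⟨S, hS, hSG, hSD | hS𝒲, rfl⟩ | rfl)
        · exact ⟨S, hS, hSG, .inl hSD, rfl⟩
        · exact ⟨S, hS, hSG, .inr (Finset.mem_of_mem_erase hS𝒲), rfl⟩
        · exact ⟨T, hT, hTG, .inr hT𝒲, rfl⟩
    · rintro Y ⟨S, hS, hSG, ⟨hST, hpS⟩, rfl⟩
      exact ⟨S, hS, hSG, .inl fun g hg hgS => Finset.mem_erase.2
        ⟨fun h => hpS (h ▸ hgS), hTD g hg (hST hgS)⟩, rfl⟩
    · rintro Y ⟨S, hS, hSG, hSD, rfl⟩ g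
      refine hlift _ g (hSG.isTame _) fun x => ?_
      rcases hSD with hSD | hS𝒲
      · have hpS : p ∉ S := fun hpS => Finset.notMem_erase p D (hSD p (hDG hpD.1) hpS)
        rw [indicator_eq_zero hpS x, map_zero]
      · rw [Finset.mem_erase] at hS𝒲
        by_contra hx
        exact hmin ⟨S, hS𝒲.2⟩ trivial ⟨fun h => hS𝒲.1 (congrArg Subtype.val h),
          hS.ordConnected, hT.ordConnected, g, x, hx⟩

open Classical in
theorem IsTame.hasFiniteApproxDim_of_subset (hG : HasFloors G) {M : PosetRep k P}
    (hM : IsTame G M) (D : Finset P) (hDG : D ⊆ G) :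
    HasFiniteApproxDim (tameSpreadRep k G (fun S => ∀ g ∈ G, g ∈ S → g ∈ D)) M := by
  induction hN : D.card generalizing D with
  | zero =>
    rw [Finset.card_eq_zero] at hN
    subst hN
    -- A tame spread contains a point of `G`, so the class is empty and a zero object, here `kernel
    -- (𝟙 M)`, approximates `M`.
    refine .step_kernel (0 : kernel (𝟙 M) ⟶ M) (.of_isZero ?_) ?_ (.zero _ ?_)
    · exact IsZero.of_iso (isZero_zero _) (kernel.ofMono _)
    · rintro Y ⟨S, hS, hSG, hSD, rfl⟩
      obtain ⟨p, hp⟩ := hS.nonempty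
      obtain ⟨m, hm, hmS, -⟩ := hSG.exists_floor hG hp
      exact absurd (hSD m hm hmS) (Finset.notMem_empty m)
    · exact IsZero.of_iso (IsZero.of_iso (isZero_zero _) (kernel.ofMono _)) kernelZeroIsoSource
  | succ N ih =>
    obtain ⟨p, hp⟩ := D.exists_minimal (Finset.card_pos.1 (by omega))
    have ih' := ih (D.erase p) ((Finset.erase_subset _ _).trans hDG)
      (by rw [Finset.card_erase_of_mem hp.1, hN]; rfl)
    have hfin : {S : Set P | IsSpread S ∧ IsTameSet G S ∧ ∀ g ∈ G, g ∈ S → g ∈ D}.Finite :=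
      (finite_setOf_isTameSet hG).subset fun S hS => hS.2.1
    have key := hM.hasFiniteApproxDim_union hG hDG hp ih' hfin.toFinset
      (fun S hS => by simpa using hS)
    convert key using 1
    funext Y
    refine propext ⟨?_, ?_⟩
    · rintro ⟨S, hS, hSG, hSD, rfl⟩
      exact ⟨S, hS, hSG, .inr (hfin.mem_toFinset.2 ⟨hS, hSG, hSD⟩), rfl⟩
    · rintro ⟨S, hS, hSG, hSD, rfl⟩
      refine ⟨S, hS, hSG, ?_, rfl⟩
      rcases hSD with h | h
      · exact fun g hg hgS => Finset.mem_of_mem_erase (h g hg hgS)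
      · exact (hfin.mem_toFinset.1 h).2.2

/-- Every tame representation has a finite resolution by direct sums of tame spread
representations. -/
theorem IsTame.hasFiniteApproxDim (hG : HasFloors G) {M : PosetRep k P} (hM : IsTame G M) :
    HasFiniteApproxDim (tameSpreadRep k G (fun _ => True)) M := by
  have := hM.hasFiniteApproxDim_of_subset hG G subset_rfl
  convert this using 2
  funext S
  exact propext ⟨fun _ g hg _ => hg, fun _ => trivial⟩

end FiniteDimension

/-! ### Maps from arbitrary convex sets factor through tame ones. -/

section Approximation

variable {k : Type v} [Field k] {P : Type u} [SemilatticeSup P] {G : Finset P}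

/-- The elements of `G` below a join are controlled by those below the two elements. -/
def FloorLESup (G : Finset P) : Prop :=
  ∀ s t q : P, (∃ g ∈ G, g ≤ s) → (∃ g ∈ G, g ≤ t) → FloorLE G s q → FloorLE G t q →
    FloorLE G (s ⊔ t) q

/-- The elements `p` such that `S` contains all large elements of the set of all `q` that lie above
the same elements of `G` as `p`. -/
def tameReflection (G : Finset P) (S : Set P) : Set P :=
  {p | ∃ t ∈ S, p ≤ t ∧ FloorLE G t p ∧ ∀ q, t ≤ q → FloorLE G q p → q ∈ S}

theorem FloorLE.exists_le {p q : P} (h : FloorLE G p q) (hp : ∃ g ∈ G, g ≤ p) :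
    ∃ g ∈ G, g ≤ q := by
  obtain ⟨g, hg, hgp⟩ := hp
  exact ⟨g, hg, h g hg hgp⟩

theorem exists_le_of_le {p q : P} (h : p ≤ q) (hp : ∃ g ∈ G, g ≤ p) : ∃ g ∈ G, g ≤ q :=
  (FloorLE.of_le h).exists_le hp

theorem isTameSet_tameReflection {S : Set P} (hsup : FloorLESup G)
    (hSG : ∀ s ∈ S, ∃ g ∈ G, g ≤ s) :
    IsTameSet G (tameReflection G S) where
  mem_iff p q hpq hqp := by
    constructor
    · rintro ⟨t, ht, hpt, htp, h⟩
      have hp := htp.exists_le (hSG t ht)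
      have hq := exists_le_of_le hpq hp
      refine ⟨t ⊔ q, h _ le_sup_left (hsup t q p (hSG t ht) hq htp hqp), le_sup_right,
        hsup t q q (hSG t ht) hq (htp.trans (.of_le hpq)) (.of_le le_rfl), fun r hr hrq => ?_⟩
      exact h r (le_sup_left.trans hr) (hrq.trans hqp)
    · rintro ⟨t, ht, hqt, htq, h⟩
      exact ⟨t, ht, hpq.trans hqt, htq.trans hqp, fun r hr hrp => h r hr (hrp.trans (.of_le hpq))⟩
  exists_le := by
    rintro p ⟨t, ht, hpt, htp, h⟩
    exact htp.exists_le (hSG t ht)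

theorem ordConnected_tameReflection {S : Set P} (hsup : FloorLESup G)
    (hSG : ∀ s ∈ S, ∃ g ∈ G, g ≤ s) (hS : S.OrdConnected) :
    (tameReflection G S).OrdConnected := by
  refine ⟨?_⟩
  rintro a ⟨t, ht, hat, hta, h⟩ b ⟨t', ht', hbt', ht'b, h'⟩ p ⟨hap, hpb⟩
  have htp : FloorLE G t p := hta.trans (.of_le hap)
  have hp := htp.exists_le (hSG t ht)
  have key : ∀ q, t ≤ q → FloorLE G q p → q ∈ S := by
    intro q hq hqp
    refine hS.out ht (h' (q ⊔ t') le_sup_right ?_) ⟨hq, le_sup_left⟩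
    exact hsup q t' b (exists_le_of_le hq (hSG t ht)) (hSG t' ht') (hqp.trans (.of_le hpb)) ht'b
  have hsp : FloorLE G (t ⊔ p) p := hsup t p p (hSG t ht) hp htp (.of_le le_rfl)
  exact ⟨t ⊔ p, key _ le_sup_left hsp, le_sup_right, hsp, fun q hq hqp =>
    key q (le_sup_left.trans hq) hqp⟩

/-- In general neither set contains the other. If `p ≤ q` with `p` in `S` and `q` in the reflection,
joins with the witness for `q` stay in `S`, and convexity puts `q` in `S` and `p` in the reflection.
-/
theorem exists_indicatorHom_tameReflection (k : Type v) [Field k] {S : Set P} (hsup : FloorLESup G)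
    (hSG : ∀ s ∈ S, ∃ g ∈ G, g ≤ s) (hS : S.OrdConnected)
    (hR : (tameReflection G S).OrdConnected) :
    ∃ f : indicatorRep k S hS ⟶ indicatorRep k (tameReflection G S) hR,
      ∀ p (hp : p ∈ S) (hp' : p ∈ tameReflection G S),
        indicatorImage f hp = indicatorGen k hR hp' := by
  refine exists_indicatorHom k hS hR ?_
  rintro p q hpq hp ⟨t, ht, hqt, htq, h⟩
  refine ⟨fun hq => ⟨p, hp, le_rfl, .of_le le_rfl, fun r hr hrp => ?_⟩, fun _ => ?_⟩
  · refine hS.out hp (h (r ⊔ t) le_sup_right ?_) ⟨hr, le_sup_left⟩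
    exact hsup r t q (exists_le_of_le hr (hSG p hp)) (hSG t ht) (hrp.trans (.of_le hpq)) htq
  · refine hS.out hp (h (q ⊔ t) le_sup_right ?_) ⟨hpq, le_sup_left⟩
    exact hsup q t q (exists_le_of_le hpq (hSG p hp)) (hSG t ht) (.of_le le_rfl) htq

/-- A tame `M` is constant on a cell, so `f` can be read off from its behaviour at large elements of
the cell. If these lie in `S`, pull back the value of `f` there; joins make it independent of the
choice. -/
theorem exists_factorization_of_bounded {S : Set P} (hsup : FloorLESup G)
    (hSG : ∀ s ∈ S, ∃ g ∈ G, g ≤ s) {M : PosetRep k P} (hM : IsTame G M)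
    (hS : S.OrdConnected) (hR : (tameReflection G S).OrdConnected) (f : indicatorRep k S hS ⟶ M) :
    ∃ (g : indicatorRep k S hS ⟶ indicatorRep k (tameReflection G S) hR)
      (h : indicatorRep k (tameReflection G S) hR ⟶ M), g ≫ h = f := by
  have hy : ∀ p, p ∈ tameReflection G S → ∃ y : M.obj p, ∀ t (ht : t ∈ S) (hpt : p ≤ t),
      FloorLE G t p → (M.map (homOfLE hpt)).hom y = indicatorImage f ht := by
    rintro p ⟨t, ht, hpt, htp, h⟩
    obtain ⟨y, hy⟩ := (hM.bijective p t (homOfLE hpt) htp).2 (indicatorImage f ht)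
    refine ⟨y, fun t' ht' hpt' ht'p => ?_⟩
    have hsp : FloorLE G (t' ⊔ t) p := hsup t' t p (hSG t' ht') (hSG t ht) ht'p htp
    have hsS : t' ⊔ t ∈ S := h _ le_sup_right hsp
    refine (hM.bijective t' (t' ⊔ t) (homOfLE le_sup_left) (hsp.trans (.of_le hpt'))).1 ?_
    rw [map_indicatorImage f _ ht' hsS, PosetRep.map_map,
      ← map_indicatorImage f (homOfLE le_sup_right) ht hsS, ← hy, PosetRep.map_map]
    rfl
  -- Outside the reflection the cell has elements outside `S` above any given `s`. Images of
  -- generators die there, hence already at `p`, since `M` is constant on the cell.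
  have hnot : ∀ p, (∃ g ∈ G, g ≤ p) → p ∉ tameReflection G S → ∀ s, s ∈ S → FloorLE G s p →
      ∃ q, p ≤ q ∧ s ≤ q ∧ FloorLE G q p ∧ q ∉ S := by
    intro p hp hpR s hs hsp
    have hsup' : FloorLE G (s ⊔ p) p := hsup s p p (hSG s hs) hp hsp (.of_le le_rfl)
    by_contra! hcon
    exact hpR ⟨s ⊔ p, hcon _ le_sup_right le_sup_left hsup', le_sup_right, hsup', fun q hq hqp =>
      hcon q (le_sup_right.trans hq) (le_sup_left.trans hq) hqp⟩
  choose y hy using hy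
  obtain ⟨h, hh⟩ := exists_indicatorDesc hR M y
    (by
      rintro p p' a hp hp'
      obtain ⟨t, ht, hpt, htp, h⟩ := id hp
      obtain ⟨t', ht', hpt', ht'p', h'⟩ := id hp'
      have hsp : FloorLE G (t ⊔ t') p' :=
        hsup t t' p' (hSG t ht) (hSG t' ht') (htp.trans (.of_le (leOfHom a))) ht'p'
      have hsS : t ⊔ t' ∈ S := h' _ le_sup_right hsp
      have hps : p' ≤ t ⊔ t' := hpt'.trans le_sup_right
      refine (hM.bijective p' (t ⊔ t') (homOfLE hps) hsp).1 ?_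
      rw [hy p' hp' _ hsS hps hsp, ← map_indicatorImage f (homOfLE le_sup_left) ht hsS,
        ← hy p hp t ht hpt htp, PosetRep.map_map, PosetRep.map_map]
      rfl)
    (by
      rintro p p' a hp hp'
      obtain ⟨t, ht, hpt, htp, h⟩ := id hp
      have hp0 := exists_le_of_le (leOfHom a) (htp.exists_le (hSG t ht))
      obtain ⟨q, hp'q, htq, hqp', hqS⟩ := hnot p' hp0 hp' t ht (htp.trans (.of_le (leOfHom a)))
      refine (hM.bijective p' q (homOfLE hp'q) hqp').1 ?_
      rw [map_zero, ← map_indicatorImage_of_notMem f (homOfLE htq) ht hqS,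
        ← hy p hp t ht hpt htp, PosetRep.map_map, PosetRep.map_map]
      rfl)
  obtain ⟨g, hg⟩ := exists_indicatorHom_tameReflection k hsup hSG hS hR
  refine ⟨g, h, indicatorRep_hom_ext fun s hs => ?_⟩
  rw [indicatorImage_comp]
  by_cases hsR : s ∈ tameReflection G S
  · rw [hg s hs hsR]
    refine (hh s hsR).trans ?_
    rw [← hy s hsR s hs le_rfl (.of_le le_rfl), PosetRep.map_self]
  · rw [indicator_eq_zero hsR (indicatorImage g hs), map_zero]
    obtain ⟨q, hsq, -, hqs, hqS⟩ := hnot s (hSG s hs) hsR s hs (.of_le le_rfl)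
    refine (hM.bijective s q (homOfLE hsq) hqs).1 ?_
    rw [map_zero, map_indicatorImage_of_notMem f _ hs hqS]

/-- `M` is zero at points above no element of `G`, so `f` kills every generator lying above such a
point of `S`. The remaining part of `S` is closed downwards in `S`, hence gives a quotient. -/
theorem exists_factorization_bounded {M : PosetRep k P} (hM : IsTame G M) {S : Set P}
    (hS : S.OrdConnected) (f : indicatorRep k S hS ⟶ M) :
    ∃ (S' : Set P) (hS' : S'.OrdConnected) (g : indicatorRep k S hS ⟶ indicatorRep k S' hS')
      (h : indicatorRep k S' hS' ⟶ M), (∀ s ∈ S', ∃ g ∈ G, g ≤ s) ∧ g ≫ h = f := by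
  let S' : Set P := {q | q ∈ S ∧ ∀ p ∈ S, p ≤ q → ∃ g ∈ G, g ≤ p}
  have hS' : S'.OrdConnected := ⟨fun a ha b hb p hp => ⟨hS.out ha.1 hb.1 hp, fun q hq hqp =>
    hb.2 q hq (hqp.trans hp.2)⟩⟩
  have hzero : ∀ q (hq : q ∈ S), q ∉ S' → indicatorImage f hq = 0 := by
    intro q hq hqS'
    have : ∃ p ∈ S, p ≤ q ∧ ∀ g ∈ G, ¬ g ≤ p := by
      by_contra! h
      exact hqS' ⟨hq, h⟩
    obtain ⟨p, hp, hpq, hpG⟩ := this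
    rw [← map_indicatorImage f (homOfLE hpq) hp hq, hM.eq_zero p hpG (indicatorImage f hp),
      map_zero]
  obtain ⟨g, hg⟩ := exists_indicatorHom k hS hS' fun p q hpq hp hq =>
    ⟨fun _ => ⟨hp, fun r hr hrp => hq.2 r hr (hrp.trans hpq)⟩, fun _ => hq.1⟩
  obtain ⟨h, hh⟩ := exists_indicatorDesc hS' M (fun p hp => indicatorImage f hp.1)
    (fun p q a hp hq => map_indicatorImage f a hp.1 hq.1)
    (fun p q a hp hq => by
      by_cases hqS : q ∈ S
      · rw [map_indicatorImage f a hp.1 hqS, hzero q hqS hq]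
      · exact map_indicatorImage_of_notMem f a hp.1 hqS)
  refine ⟨S', hS', g, h, fun s hs => hs.2 s hs.1 le_rfl, indicatorRep_hom_ext fun s hs => ?_⟩
  rw [indicatorImage_comp]
  by_cases hsS' : s ∈ S'
  · rw [hg s hs hsS']
    exact hh s hsS'
  · rw [indicator_eq_zero hsS' (indicatorImage g hs), map_zero, hzero s hs hsS']

/-- If all morphisms from tame spread representations to a tame representation `M` lift along
`f`, then so do the morphisms from the indicator representations of convex sets. -/
theorem IsTame.exists_lift_of_ordConnected (hG : HasFloors G) (hsup : FloorLESup G)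
    {C M : PosetRep k P} (hM : IsTame G M) (f : C ⟶ M)
    (hf : ∀ Y, tameSpreadRep k G (fun _ => True) Y → ∀ g : Y ⟶ M, ∃ h, h ≫ f = g) {S : Set P}
    (hS : S.OrdConnected) (g : indicatorRep k S hS ⟶ M) : ∃ h, h ≫ f = g := by
  obtain ⟨S', hS', g₁, g₂, hS'G, rfl⟩ := exists_factorization_bounded hM hS g
  have hR := ordConnected_tameReflection hsup hS'G hS'
  obtain ⟨g₃, g₄, rfl⟩ := exists_factorization_of_bounded hsup hS'G hM hS' hR g₂
  have hsum : FiniteSum (tameSpreadRep k G (fun _ => True)) (indicatorRep k _ hR) :=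
    ((isTameSet_tameReflection hsup hS'G).finiteSum hG hR).mono (by
      rintro Y ⟨S, hS, hSG, -, rfl⟩
      exact ⟨S, hS, hSG, trivial, rfl⟩)
  obtain ⟨h, rfl⟩ := hsum.exists_lift f hf g₄
  exact ⟨g₁ ≫ g₃ ≫ h, by simp only [Category.assoc]⟩

end Approximation

/-! ### Joins in a grid. -/

section GridSup

variable {n : ℕ} {T : Fin n → Type u} [∀ i, LinearOrder (T i)]

theorem floorLESup_piFinset (H : ∀ i, Finset (T i)) : FloorLESup (Fintype.piFinset H) := by
  have key : ∀ s q g : (∀ i, T i), (∃ g ∈ Fintype.piFinset H, g ≤ s) →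
      FloorLE (Fintype.piFinset H) s q → g ∈ Fintype.piFinset H → ∀ i, g i ≤ s i → g i ≤ q i := by
    rintro s q g ⟨a, ha, has⟩ hsq hg i hgi
    rw [Fintype.mem_piFinset] at ha hg
    -- Only coordinate `i` of `g` is known to be below `s`. Substituting it into a grid point `a ≤
    -- s` gives a grid point below `s`; this is why `s` must lie above some grid point.
    have := hsq (Function.update a i (g i)) (Fintype.mem_piFinset.2 fun j => ?_) (fun j => ?_) i
    · simpa using this
    · by_cases h : j = i
      · subst h
        simpa using hg j
      · simpa [h] using ha j
    · by_cases h : j = i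
      · subst h
        simpa using hgi
      · simpa [h] using has j
  intro s t q hs ht hsq htq g hg hgst i
  rcases le_sup_iff.1 (hgst i) with h | h
  · exact key s q g hs hsq hg i h
  · exact key t q g ht htq hg i h

end GridSup

/-! ### Relative projectives and resolutions in a preadditive category. -/

section RelativeHomologicalAlgebra

variable {A : Type w} [Category.{w'} A] [Preadditive A]

theorem shortExact_map_preadditiveCoyoneda_iff (S : ShortComplex A) (X : A) :
    (S.map (preadditiveCoyoneda.obj (Opposite.op X))).ShortExact ↔
      (∀ a b : X ⟶ S.X₁, a ≫ S.f = b ≫ S.f → a = b) ∧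
      (∀ x : X ⟶ S.X₂, x ≫ S.g = 0 → ∃ a, a ≫ S.f = x) ∧
      ∀ y : X ⟶ S.X₃, ∃ x, x ≫ S.g = y := by
  constructor
  · intro h
    refine ⟨fun a b hab => ?_, fun x hx => ?_, fun y => ?_⟩
    · exact (AddCommGrpCat.mono_iff_injective _).1 h.mono_f hab
    · exact (ShortComplex.ab_exact_iff _).1 h.exact x hx
    · exact (AddCommGrpCat.epi_iff_surjective _).1 h.epi_g y
  · rintro ⟨h₁, h₂, h₃⟩
    exact .mk' ((ShortComplex.ab_exact_iff _).2 h₂)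
      ((AddCommGrpCat.mono_iff_injective _).2 fun a b hab => h₁ a b hab)
      ((AddCommGrpCat.epi_iff_surjective _).2 h₃)

/-- `A` is not assumed abelian, so exactness is witnessed by explicit homology data with zero
homology. -/
theorem ShortComplex.shortExact_of_isLimit_of_isColimit [HasZeroObject A] (S : ShortComplex A)
    (hf : IsLimit (KernelFork.ofι S.f S.zero)) (hg : IsColimit (CokernelCofork.ofπ S.g S.zero)) :
    S.ShortExact := by
  have hf' : hf.lift (KernelFork.ofι S.f S.zero) = 𝟙 _ := Fork.IsLimit.hom_ext hf (by
    rw [Fork.IsLimit.lift_ι]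
    exact (Category.id_comp _).symm)
  have hg' : hg.desc (CokernelCofork.ofπ S.g S.zero) = 𝟙 _ := Cofork.IsColimit.hom_ext hg (by
    rw [Cofork.IsColimit.π_desc]
    exact (Category.comp_id _).symm)
  open ZeroObject in
  let l : S.LeftHomologyData :=
    { K := S.X₁
      H := 0
      i := S.f
      π := 0
      wi := S.zero
      hi := hf
      wπ := comp_zero
      hπ := CokernelCofork.IsColimit.ofπ _ _ (fun _ _ => 0)
        (fun g hg => by
          rw [hf', Category.id_comp] at hg
          rw [hg, comp_zero])
        (fun g hg m hm => (isZero_zero A).eq_of_src _ _) }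
  open ZeroObject in
  let r : S.RightHomologyData :=
    { Q := S.X₃
      H := 0
      p := S.g
      ι := 0
      wp := S.zero
      hp := hg
      wι := zero_comp
      hι := KernelFork.IsLimit.ofι _ _ (fun _ _ => 0)
        (fun g hg => by
          rw [hg'] at hg
          exact zero_comp.trans ((Category.comp_id g).symm.trans hg).symm)
        (fun g hg m hm => (isZero_zero A).eq_of_tgt _ _) }
  refine .mk' ⟨⟨l, r, Iso.refl _, ?_⟩, isZero_zero A⟩ ⟨fun a b h => Fork.IsLimit.hom_ext hf h⟩
    ⟨fun a b h => Cofork.IsColimit.hom_ext hg h⟩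
  change (0 : S.X₁ ⟶ _) ≫ _ ≫ _ = S.f ≫ S.g
  rw [zero_comp, S.zero]

variable {𝒳 𝒞 : ObjectProperty A}

theorem addClosure.exists_sum_eq_id {M : A} (hM : addClosure 𝒳 M) :
    ∃ (m : ℕ) (X : Fin m → A) (a : ∀ i, M ⟶ X i) (b : ∀ i, X i ⟶ M),
      (∀ i, 𝒳 (X i)) ∧ ∑ i, a i ≫ b i = 𝟙 M := by
  obtain ⟨m, X, N, s, b, hX, ⟨hs⟩, ⟨hb⟩, ⟨e⟩⟩ := hM
  refine ⟨m, X, fun i => s.inl ≫ e.hom ≫ b.π i, fun i => b.ι i ≫ e.inv ≫ s.fst, hX, ?_⟩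
  have : ∑ i, (s.inl ≫ e.hom ≫ b.π i) ≫ b.ι i ≫ e.inv ≫ s.fst =
      s.inl ≫ e.hom ≫ (∑ i, b.π i ≫ b.ι i) ≫ e.inv ≫ s.fst := by
    simp only [Preadditive.sum_comp, Preadditive.comp_sum, Category.assoc]
  rw [this, IsBilimit.total hb]
  simp

theorem addClosure.exists_lift {C M Z : A} (hZ : addClosure 𝒳 Z) (f : C ⟶ M)
    (hf : ∀ X, 𝒳 X → ∀ g : X ⟶ M, ∃ l, l ≫ f = g) (g : Z ⟶ M) : ∃ l, l ≫ f = g := by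
  obtain ⟨m, X, a, b, hX, hab⟩ := hZ.exists_sum_eq_id
  choose l hl using fun i => hf (X i) (hX i) (b i ≫ g)
  refine ⟨∑ i, a i ≫ l i, ?_⟩
  rw [Preadditive.sum_comp]
  simp only [Category.assoc, hl]
  simp only [← Category.assoc]
  rw [← Preadditive.sum_comp, hab, Category.id_comp]

theorem addClosure.relativeProjective {M : A} (hM : addClosure 𝒳 M) :
    RelativeProjective 𝒳 M := by
  rintro S ⟨-, hS⟩
  simp only [shortExact_map_preadditiveCoyoneda_iff] at hS ⊢
  obtain ⟨m, X, a, b, hX, hab⟩ := hM.exists_sum_eq_id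
  have hsum : ∀ {Y : A} (g : M ⟶ Y), ∑ i, a i ≫ b i ≫ g = g := by
    intro Y g
    simp only [← Category.assoc]
    rw [← Preadditive.sum_comp, hab, Category.id_comp]
  refine ⟨fun x y hxy => ?_, fun x hx => ?_, fun y => ?_⟩
  · rw [← hsum x, ← hsum y]
    refine Finset.sum_congr rfl fun i _ => ?_
    rw [(hS (X i) (hX i)).1 (b i ≫ x) (b i ≫ y) (by rw [Category.assoc, hxy, Category.assoc])]
  · choose c hc using fun i => (hS (X i) (hX i)).2.1 (b i ≫ x) (by
      rw [Category.assoc, hx, comp_zero])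
    refine ⟨∑ i, a i ≫ c i, ?_⟩
    rw [Preadditive.sum_comp]
    simp only [Category.assoc, hc]
    exact hsum x
  · exact hM.exists_lift S.g (fun X hX => (hS X hX).2.2) y

theorem IsApproximation.of_lift {C M : A} (f : C ⟶ M) (hC : addClosure 𝒳 C)
    (hf : ∀ X, 𝒳 X → ∀ g : X ⟶ M, ∃ l, l ≫ f = g) : IsApproximation (addClosure 𝒳) f :=
  ⟨hC, fun _ hZ g => hZ.exists_lift f hf g⟩

/-- If an object has an approximation by a direct sum of objects of `𝒳` which is a cokernel of its
kernel, then it is a direct summand of that sum as soon as it is relatively projective. -/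
theorem RelativeProjective.addClosure [HasZeroObject A] {K C M : A} (hM : RelativeProjective 𝒳 M)
    (i : K ⟶ C) (f : C ⟶ M) (w : i ≫ f = 0) (hi : IsLimit (KernelFork.ofι i w))
    (hf : IsColimit (CokernelCofork.ofπ f w))
    (hlift : ∀ X, 𝒳 X → ∀ g : X ⟶ M, ∃ l, l ≫ f = g) {m : ℕ} {X : Fin m → A}
    (hX : ∀ j, 𝒳 (X j)) (b : Bicone X) (hb : b.IsBilimit) (e : C ≅ b.pt) :
    addClosure 𝒳 M := by
  let S : ShortComplex A := .mk i f w
  have hmono : ∀ {W : A} (a b : W ⟶ K), a ≫ i = b ≫ i → a = b :=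
    fun a b h => Fork.IsLimit.hom_ext hi h
  have hS : RelativeShortExact 𝒳 S := by
    refine ⟨ShortComplex.shortExact_of_isLimit_of_isColimit S hi hf, fun Y hY => ?_⟩
    rw [shortExact_map_preadditiveCoyoneda_iff]
    exact ⟨fun a b h => hmono a b h, fun x hx => ⟨hi.lift (KernelFork.ofι x hx),
      Fork.IsLimit.lift_ι hi⟩, hlift Y hY⟩
  -- Relative projectivity lifts `𝟙 M` to a section of `f`; the kernel `K` becomes the complement.
  obtain ⟨s, hs⟩ := ((shortExact_map_preadditiveCoyoneda_iff _ _).1 (hM S hS)).2.2 (𝟙 M)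
  change s ≫ f = 𝟙 M at hs
  have h0 : (𝟙 C - f ≫ s) ≫ f = 0 := by
    rw [Preadditive.sub_comp, Category.assoc, hs, Category.id_comp, Category.comp_id, sub_self]
  let r : C ⟶ K := hi.lift (KernelFork.ofι _ h0)
  have hr : r ≫ i = 𝟙 C - f ≫ s := Fork.IsLimit.lift_ι hi
  refine ⟨m, X, K,
    { pt := C
      fst := f
      snd := r
      inl := s
      inr := i
      inl_fst := hs
      inl_snd := hmono _ _ ?_
      inr_fst := w
      inr_snd := hmono _ _ ?_ }, b, hX, ⟨isBinaryBilimitOfTotal _ ?_⟩, ⟨hb⟩, ⟨e⟩⟩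
  · rw [Category.assoc, hr, Preadditive.comp_sub, reassoc_of% hs, Category.comp_id, sub_self,
      zero_comp]
  · rw [Category.assoc, hr, Preadditive.comp_sub, reassoc_of% w, zero_comp, sub_zero,
      Category.comp_id, Category.id_comp]
  · change f ≫ s + r ≫ i = 𝟙 C
    rw [hr, add_sub_cancel]

theorem addClosure.of_bicone {C Z : A} (hZ : IsZero Z) {m : ℕ} {X : Fin m → A}
    (hX : ∀ j, 𝒳 (X j)) (b : Bicone X) (hb : b.IsBilimit) (e : C ≅ b.pt) : addClosure 𝒳 C :=
  ⟨m, X, Z,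
    { pt := C
      fst := 𝟙 C
      snd := 0
      inl := 𝟙 C
      inr := 0
      inl_snd := hZ.eq_of_tgt _ _
      inr_snd := hZ.eq_of_tgt _ _ }, b, hX,
    ⟨isBinaryBilimitOfTotal _ (by simp)⟩, ⟨hb⟩, ⟨e⟩⟩

/-- The resolution of a zero object. -/
def RelativeResolution.ofIsZero {M : A} (hM : IsZero M) (h𝒞 : 𝒞 M) : RelativeResolution 𝒞 M where
  C _ := M
  ε := 0
  d _ := 0
  approx_ε := ⟨h𝒞, fun _ _ _ => ⟨0, hM.eq_of_tgt _ _⟩⟩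
  approx_d_zero := ⟨KernelFork.ofι (0 : M ⟶ M) (hM.eq_of_tgt _ _), (0 : M ⟶ M),
    ⟨KernelFork.IsLimit.ofι _ _ (fun _ _ => 0) (fun _ _ => hM.eq_of_tgt _ _)
      (fun _ _ _ _ => hM.eq_of_tgt _ _)⟩,
    ⟨h𝒞, fun _ _ _ => ⟨0, hM.eq_of_tgt _ _⟩⟩, hM.eq_of_tgt _ _⟩
  approx_d_succ _ := ⟨KernelFork.ofι (0 : M ⟶ M) (hM.eq_of_tgt _ _), (0 : M ⟶ M),
    ⟨KernelFork.IsLimit.ofι _ _ (fun _ _ => 0) (fun _ _ => hM.eq_of_tgt _ _)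
      (fun _ _ _ _ => hM.eq_of_tgt _ _)⟩,
    ⟨h𝒞, fun _ _ _ => ⟨0, hM.eq_of_tgt _ _⟩⟩, hM.eq_of_tgt _ _⟩

/-- A resolution of the kernel of an approximation gives a resolution. -/
def RelativeResolution.cons {K C M : A} (i : K ⟶ C) (f : C ⟶ M) (w : i ≫ f = 0)
    (hi : IsLimit (KernelFork.ofι i w)) (hf : IsApproximation 𝒞 f) (R : RelativeResolution 𝒞 K) :
    RelativeResolution 𝒞 M where
  C
    | 0 => C
    | j + 1 => R.C j
  ε := f
  d
    | 0 => R.ε ≫ i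
    | j + 1 => R.d j
  approx_ε := hf
  approx_d_zero := ⟨_, R.ε, ⟨hi⟩, R.approx_ε, rfl⟩
  approx_d_succ
    -- The differential is `R.ε ≫ i` with `i` mono, so it has the same kernel as `R.ε`.
    | 0 => by
      obtain ⟨κ, a, ⟨hκ⟩, ha, h⟩ := R.approx_d_zero
      have : Mono i := ⟨fun _ _ h => Fork.IsLimit.hom_ext hi h⟩
      exact ⟨_, a, ⟨isKernelCompMono hκ i rfl⟩, ha, h⟩
    | j + 1 => R.approx_d_succ j

theorem RelativeResolution.IsFinite.cons {K C M : A} (i : K ⟶ C) (f : C ⟶ M) (w : i ≫ f = 0)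
    (hi : IsLimit (KernelFork.ofι i w)) (hf : IsApproximation 𝒞 f) {R : RelativeResolution 𝒞 K}
    (hR : R.IsFinite) : (R.cons i f w hi hf).IsFinite := by
  obtain ⟨n, hn⟩ := hR
  refine ⟨n + 1, fun j hj => ?_⟩
  obtain ⟨j, rfl⟩ : ∃ j', j = j' + 1 := ⟨j - 1, by omega⟩
  exact hn j (by omega)

end RelativeHomologicalAlgebra

/-! ### Kernels and cokernels in full subcategories. -/

section FullSubcategory

variable {A : Type w} [Category.{w'} A] [Preadditive A] {𝒬 : ObjectProperty A}

/-- A kernel in the ambient category is a kernel in a full subcategory. -/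
def isLimitKernelForkOfHom {K C M : 𝒬.FullSubcategory} (i : K ⟶ C) (f : C ⟶ M)
    (w' : i.hom ≫ f.hom = 0) (w : i ≫ f = 0) (h : IsLimit (KernelFork.ofι i.hom w')) :
    IsLimit (KernelFork.ofι i w) :=
  have : Mono i := ⟨fun _ _ hab => ObjectProperty.hom_ext _
    (Fork.IsLimit.hom_ext h (congrArg InducedCategory.Hom.hom hab))⟩
  KernelFork.IsLimit.ofι' i w fun g hg =>
    ⟨ObjectProperty.homMk (h.lift (KernelFork.ofι g.hom (congrArg InducedCategory.Hom.hom hg))),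
      ObjectProperty.hom_ext _ (Fork.IsLimit.lift_ι h)⟩

/-- A cokernel in the ambient category is a cokernel in a full subcategory. -/
def isColimitCokernelCoforkOfHom {K C M : 𝒬.FullSubcategory} (i : K ⟶ C) (f : C ⟶ M)
    (w' : i.hom ≫ f.hom = 0) (w : i ≫ f = 0) (h : IsColimit (CokernelCofork.ofπ f.hom w')) :
    IsColimit (CokernelCofork.ofπ f w) :=
  have : Epi f := ⟨fun _ _ hab => ObjectProperty.hom_ext _
    (Cofork.IsColimit.hom_ext h (congrArg InducedCategory.Hom.hom hab))⟩
  CokernelCofork.IsColimit.ofπ' f w fun g hg =>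
    ⟨ObjectProperty.homMk (h.desc (CokernelCofork.ofπ g.hom
      (congrArg InducedCategory.Hom.hom hg))),
      ObjectProperty.hom_ext _ (Cofork.IsColimit.π_desc h)⟩

theorem isZero_of_isZero_obj {M : 𝒬.FullSubcategory} (hM : IsZero M.obj) : IsZero M := by
  rw [IsZero.iff_id_eq_zero]
  exact ObjectProperty.hom_ext _ (hM.eq_of_src _ _)

end FullSubcategory

/-! ### Spread resolutions and projectives among finitely presented representations. -/

section SpreadResolutions

variable {k : Type v} [Field k] {P : Type u} {G : Finset P}

attribute [local instance] Abelian.hasFiniteBiproducts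

theorem exists_isZero_fPRep [PartialOrder P] (hG : HasFloors G) :
    ∃ Z : FPRep k P, IsZero Z := by
  have h : IsZero (⨁ (PEmpty.elim : PEmpty → PosetRep k P)) := by
    rw [IsZero.iff_id_eq_zero]
    exact biproduct.hom_ext _ _ fun j => PEmpty.elim j
  have ht : IsTame G (⨁ (PEmpty.elim : PEmpty → PosetRep k P)) :=
    IsTame.biproduct fun j => PEmpty.elim j
  exact ⟨⟨_, ht.isFinitelyPresentedRep hG⟩, isZero_of_isZero_obj h⟩

theorem exists_bicone_of_finiteSum [PartialOrder P] (hG : HasFloors G) {C : FPRep k P}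
    (hC : FiniteSum (tameSpreadRep k G fun _ => True) C.obj) :
    ∃ (m : ℕ) (X : Fin m → FPRep k P) (b : Bicone X), (∀ j, isSpreadRep k P (X j)) ∧
      Nonempty b.IsBilimit ∧ Nonempty (C ≅ b.pt) := by
  obtain ⟨J, _, X, hX, ⟨e⟩⟩ := hC
  have htame : ∀ j, IsTame G (X j) := fun j => (hX j).isTame
  let ε := (Fintype.equivFin J).symm
  let Y : Fin (Fintype.card J) → FPRep k P := fun j =>
    ⟨X (ε j), (htame (ε j)).isFinitelyPresentedRep hG⟩
  let b : Bicone Y :=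
    { pt := C
      π j := ObjectProperty.homMk (e.hom ≫ biproduct.π X (ε j))
      ι j := ObjectProperty.homMk (biproduct.ι X (ε j) ≫ e.inv)
      ι_π j j' := by
        refine ObjectProperty.hom_ext _ ?_
        split_ifs with h
        · subst h
          simp [Y]
        · have h' : ε j ≠ ε j' := fun h' => h (ε.injective h')
          simp [Y, biproduct.ι_π_ne _ h'] }
  refine ⟨_, Y, b, fun j => ?_, ⟨isBilimitOfTotal b ?_⟩, ⟨Iso.refl C⟩⟩
  · obtain ⟨S, hS, -, -, h⟩ := hX (ε j)
    exact ⟨S, hS, ⟨eqToIso h⟩⟩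
  · refine (isFinitelyPresentedRep k P).ι.map_injective ?_
    rw [Functor.map_sum]
    have : ∀ j, (isFinitelyPresentedRep k P).ι.map (b.π j ≫ b.ι j) =
        e.hom ≫ (biproduct.π X (ε j) ≫ biproduct.ι X (ε j)) ≫ e.inv := by
      intro j
      change (e.hom ≫ biproduct.π X (ε j)) ≫ biproduct.ι X (ε j) ≫ e.inv = _
      simp only [Category.assoc]
    simp only [this]
    rw [← Preadditive.comp_sum, ← Preadditive.sum_comp,
      ε.sum_comp fun j => biproduct.π X j ≫ biproduct.ι X j, biproduct.total, Category.id_comp,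
      e.hom_inv_id]
    rfl

theorem isSpreadDecomposable_of_finiteSum [PartialOrder P] (hG : HasFloors G) {C : FPRep k P}
    (hC : FiniteSum (tameSpreadRep k G fun _ => True) C.obj) : isSpreadDecomposable k P C := by
  obtain ⟨m, X, b, hX, ⟨hb⟩, ⟨e⟩⟩ := exists_bicone_of_finiteSum hG hC
  obtain ⟨Z, hZ⟩ := exists_isZero_fPRep (k := k) hG
  exact addClosure.of_bicone hZ hX b hb e

theorem exists_lift_of_isSpreadRep [SemilatticeSup P] (hG : HasFloors G) (hsup : FloorLESup G)
    {C M : FPRep k P} (hM : IsTame G M.obj) (f : C ⟶ M)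
    (hf : ∀ Y, tameSpreadRep k G (fun _ => True) Y → ∀ g : Y ⟶ M.obj, ∃ h, h ≫ f.hom = g)
    (X : FPRep k P) (hX : isSpreadRep k P X) (g : X ⟶ M) : ∃ l, l ≫ f = g := by
  obtain ⟨S, hS, ⟨e⟩⟩ := hX
  obtain ⟨l, hl⟩ := hM.exists_lift_of_ordConnected hG hsup f.hom hf hS.ordConnected
    (e.inv ≫ g.hom)
  refine ⟨ObjectProperty.homMk (e.hom ≫ l), ObjectProperty.hom_ext _ ?_⟩
  change (e.hom ≫ l) ≫ f.hom = g.hom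
  rw [Category.assoc, hl, e.hom_inv_id_assoc]

/-- Each element of `M` is the image of a generator of an upset representation; upsets are convex,
so the corresponding map lifts. -/
theorem IsTame.epi_of_lift [SemilatticeSup P] (hG : HasFloors G) (hsup : FloorLESup G)
    {C M : PosetRep k P} (hM : IsTame G M) (f : C ⟶ M)
    (hf : ∀ Y, tameSpreadRep k G (fun _ => True) Y → ∀ g : Y ⟶ M, ∃ h, h ≫ f = g) : Epi f := by
  rw [PosetRep.epi_iff]
  intro p x
  obtain ⟨g, hg⟩ := exists_upsetRep_hom p x
  obtain ⟨l, rfl⟩ := hM.exists_lift_of_ordConnected hG hsup f hf Set.ordConnected_Ici g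
  exact ⟨indicatorImage l Set.self_mem_Ici, hg⟩

theorem IsTame.exists_finite_resolution [SemilatticeSup P] (hG : HasFloors G)
    (hsup : FloorLESup G) {M : PosetRep k P} (hM : IsTame G M) :
    ∃ R : RelativeResolution (isSpreadDecomposable k P)
      (⟨M, hM.isFinitelyPresentedRep hG⟩ : FPRep k P), R.IsFinite := by
  have h := hM.hasFiniteApproxDim hG
  induction h with
  | zero M h =>
    have hZ : IsZero (⟨M, hM.isFinitelyPresentedRep hG⟩ : FPRep k P) := isZero_of_isZero_obj h
    have hd : isSpreadDecomposable k P (⟨M, hM.isFinitelyPresentedRep hG⟩ : FPRep k P) :=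
      isSpreadDecomposable_of_finiteSum hG (.of_isZero h)
    exact ⟨.ofIsZero hZ hd, 0, fun _ _ => hZ⟩
  | @step K C M i f w hi hC hf hK ih =>
    have hC' : IsTame G C := hC.isTame fun Y hY => hY.isTame
    have hK' : IsTame G K := hC'.of_isKernel hM hi.some
    obtain ⟨R, hR⟩ := ih hK'
    let C₀ : FPRep k P := ⟨C, hC'.isFinitelyPresentedRep hG⟩
    let M₀ : FPRep k P := ⟨M, hM.isFinitelyPresentedRep hG⟩
    let K₀ : FPRep k P := ⟨K, hK'.isFinitelyPresentedRep hG⟩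
    let f₀ : C₀ ⟶ M₀ := ObjectProperty.homMk f
    let i₀ : K₀ ⟶ C₀ := ObjectProperty.homMk i
    have w₀ : i₀ ≫ f₀ = 0 := ObjectProperty.hom_ext _ w
    have happ : IsApproximation (isSpreadDecomposable k P) f₀ :=
      .of_lift f₀ (isSpreadDecomposable_of_finiteSum hG hC)
        (exists_lift_of_isSpreadRep hG hsup hM f₀ hf)
    have hi₀ := isLimitKernelForkOfHom i₀ f₀ w w₀ hi.some
    exact ⟨R.cons i₀ f₀ w₀ hi₀ happ, hR.cons i₀ f₀ w₀ hi₀ happ⟩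

theorem IsTame.isSpreadDecomposable_of_relativeProjective [SemilatticeSup P] (hG : HasFloors G)
    (hsup : FloorLESup G) {M : FPRep k P} (hM : IsTame G M.obj)
    (hproj : RelativeProjective (isSpreadRep k P) M) : isSpreadDecomposable k P M := by
  obtain ⟨Z, hZ⟩ := exists_isZero_fPRep (k := k) hG
  have : HasZeroObject (FPRep k P) := ⟨Z, hZ⟩
  have h := hM.hasFiniteApproxDim hG
  cases h with
  | zero _ h => exact isSpreadDecomposable_of_finiteSum hG (.of_isZero h)
  | @step K C _ i f w hi hC hf hK =>
    have hC' : IsTame G C := hC.isTame fun Y hY => hY.isTame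
    have hK' : IsTame G K := hC'.of_isKernel hM hi.some
    let C₀ : FPRep k P := ⟨C, hC'.isFinitelyPresentedRep hG⟩
    let K₀ : FPRep k P := ⟨K, hK'.isFinitelyPresentedRep hG⟩
    let f₀ : C₀ ⟶ M := ObjectProperty.homMk f
    let i₀ : K₀ ⟶ C₀ := ObjectProperty.homMk i
    have w₀ : i₀ ≫ f₀ = 0 := ObjectProperty.hom_ext _ w
    have : Epi f := hM.epi_of_lift hG hsup f hf
    obtain ⟨m, X, b, hX, ⟨hb⟩, ⟨e⟩⟩ := exists_bicone_of_finiteSum (C := C₀) hG hC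
    exact hproj.addClosure i₀ f₀ w₀ (isLimitKernelForkOfHom i₀ f₀ w w₀ hi.some)
      (isColimitCokernelCoforkOfHom i₀ f₀ w w₀ (Abelian.epiIsCokernelOfKernel _ hi.some))
      (exists_lift_of_isSpreadRep hG hsup hM f₀ hf) hX b hb e

end SpreadResolutions

end

theorem mainTheorem2 (k : Type v) [Field k] (n : ℕ) (T : Fin n → Type u)
    [∀ i, LinearOrder (T i)] :
    (∀ M : FPRep k (∀ i, T i),
      RelativeProjective (isSpreadRep k (∀ i, T i)) M ↔ isSpreadDecomposable k (∀ i, T i) M) ∧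
    (∀ M : FPRep k (∀ i, T i),
      ∃ R : RelativeResolution (isSpreadDecomposable k (∀ i, T i)) M, R.IsFinite) := by
  refine ⟨fun M => ⟨fun h => ?_, fun h => addClosure.relativeProjective h⟩, fun M => ?_⟩
  · obtain ⟨H, hM⟩ := exists_isTame_of_isFinitelyPresentedRep M.property
    exact IsTame.isSpreadDecomposable_of_relativeProjective (hasFloors_piFinset H)
      (floorLESup_piFinset H) hM h
  · obtain ⟨H, hM⟩ := exists_isTame_of_isFinitelyPresentedRep M.property
    exact IsTame.exists_finite_resolution (hasFloors_piFinset H) (floorLESup_piFinset H) hM
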